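/- Let $n,s,t$ be integers with $s,t\in\{1,2,\ldots,\lfloor n/2\rfloor\}$, such that none of $2s,\ 2t,\ 2(s+t),\ 3s+t,\ 3s-t,\ 4s$ equals $n$, $3s\neq t$, $3t\neq s$, and $4t=n$. Let $C_n(s,t)$ be the circulant graph with vertex set $\mathbb Z/n$ in which $x,y$ are adjacent if and only if $x-y\in\{\pm s,\pm t\}$ modulo $n$, and let $\mathcal N(C_n(s,t))$ be its neighborhood complex, whose simplices are the non-empty sets of vertices that have a common neighbor. Then there is an integer $m\ge 4$ with the following two properties. 1. $\mathcal N(C_n(s,t))$ collapses, by a finite sequence of simplicial collapses, to a subcomplex that is a disjoint union of finitely many complexes $\Delta_1,\ldots,\Delta_r$, where each $\Delta_a$ is the union of the boundaries of $m$ $3$-simplices $\Gamma_i$ $(i\in\mathbb Z/m)$ glued cyclically along edges: $\Gamma_i\cap\Gamma_{i+1}$ consists of exactly two vertices for every $i$, and $\Gamma_i\cap\Gamma_j=\emptyset$ whenever $j\notin\{i-1,i,i+1\}$. 2. Each connected component of (the geometric realization of) $\mathcal N(C_n(s,t))$ is homotopy equivalent to a garland of $m$ $2$-spheres, that is, to a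 topological space $Y=\bigcup_{i\in\mathbb Z/m}X_i$ with closed subspaces $X_i$ homeomorphic to $S^2$, such that $|X_i\cap X_j|=1$ if $i\neq j$ are cyclically adjacent ($j\equiv i\pm1$ modulo $m$), and $X_i\cap X_j=\emptyset$ for all other $i\neq j$. (A simplicial collapse removes from a complex all simplices $\gamma$ with $\sigma\subseteq\gamma\subseteq\tau$, where $\sigma\subsetneq\tau$ are simplices and $\tau$ is the only maximal simplex containing $\sigma$.) -/

import Mathlib

open Topology

/-- The neighborhood complex of a graph: its faces are the non-empty finite sets of vertices that
have a common neighbor (so its vertices are the non-isolated vertices of the graph). -/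
def neighborhoodComplex {V : Type*} (G : SimpleGraph V) : PreAbstractSimplicialComplex V where
  faces := {σ | σ.Nonempty ∧ ∃ w, ∀ v ∈ σ, G.Adj w v}
  isRelLowerSet_faces := by
    rintro σ ⟨hne, w, hw⟩
    exact ⟨hne, fun τ hτ hτne => ⟨hτne, w, fun v hv => hw v (hτ hv)⟩⟩

/-- The boundary of the simplex with vertex set `τ`: all its non-empty proper faces. -/
def simplexBoundary {V : Type*} (τ : Finset V) : PreAbstractSimplicialComplex V where
  faces := {σ | σ.Nonempty ∧ σ ⊂ τ}
  isRelLowerSet_faces := by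
    rintro σ ⟨hne, hσ⟩
    exact ⟨hne, fun ρ hρ hρne => ⟨hρne, lt_of_le_of_lt hρ hσ⟩⟩

/-- `L` arises from `K` by one simplicial collapse: `σ ⊊ τ` are faces of `K`, `τ` is the only
maximal face of `K` that contains `σ`, and `L` is `K` without the faces between `σ` and `τ`. -/
def ElementaryCollapse {V : Type*} (K L : PreAbstractSimplicialComplex V) : Prop :=
  ∃ σ ∈ K, ∃ τ, Maximal (· ∈ K) τ ∧ σ ⊂ τ ∧
    (∀ ρ, Maximal (· ∈ K) ρ → σ ⊆ ρ → ρ = τ) ∧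
    L.faces = K.faces \ {γ | σ ⊆ γ ∧ γ ⊆ τ}

/-- `K` collapses to `L` by a finite sequence of simplicial collapses. -/
def Collapses {V : Type*} (K L : PreAbstractSimplicialComplex V) : Prop :=
  Relation.ReflTransGen ElementaryCollapse K L

/-- `K` is the union of the boundaries of `m` 3-simplices `Γ i`, indexed cyclically, in which
cyclically consecutive ones have exactly an edge in common and all other pairs are disjoint. -/
def IsTetrahedraCycle {V : Type*} [DecidableEq V] (m : ℕ) (K : PreAbstractSimplicialComplex V) :
    Prop :=
  ∃ Γ : ZMod m → Finset V,
    (∀ i, (Γ i).card = 4) ∧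
    (∀ i, (Γ i ∩ Γ (i + 1)).card = 2) ∧
    (∀ i j, i ≠ j → j ≠ i + 1 → i ≠ j + 1 → Disjoint (Γ i) (Γ j)) ∧
    K = ⨆ i, simplexBoundary (Γ i)

/-- The geometric realization of a simplicial complex on a finite vertex set, as a subset of the
standard simplex: the points whose support lies in a face. -/
def geometricRealization {V : Type*} [Fintype V] (K : PreAbstractSimplicialComplex V) :
    Set (V → ℝ) :=
  {x | x ∈ stdSimplex ℝ V ∧ ∃ σ ∈ K, ∀ v, x v ≠ 0 → v ∈ σ}

/-- `Y` is a garland of its closed subspaces `X i`, `i ∈ ℤ/m`: they cover `Y`, cyclically adjacent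
ones meet in exactly one point, and all other pairs are disjoint. -/
structure IsGarland {Y : Type*} [TopologicalSpace Y] (m : ℕ) (X : ZMod m → Set Y) : Prop where
  ne_zero : m ≠ 0
  isClosed : ∀ i, IsClosed (X i)
  iUnion_eq : ⋃ i, X i = Set.univ
  inter_adjacent : ∀ i j, i ≠ j → (j = i + 1 ∨ i = j + 1) → (X i ∩ X j).encard = 1
  inter_nonadjacent : ∀ i j, i ≠ j → ¬ (j = i + 1 ∨ i = j + 1) → X i ∩ X j = ∅

/-- `Y` is a garland of `m` spheres `S²`. -/
def IsSphereGarland (m : ℕ) (Y : Type*) [TopologicalSpace Y] : Prop :=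
  ∃ X : ZMod m → Set Y, IsGarland m X ∧
    ∀ i, Nonempty (X i ≃ₜ Metric.sphere (0 : EuclideanSpace ℝ (Fin 3)) 1)

/-! Combinatorics. The maximal simplices are the tetrahedra `N(w) = {w ± s, w ± t}`. The arithmetic
conditions make the pair `{w + s, w - s}` a free edge: it lies in `N(w)` and in no other
neighborhood (`eq_of_mem_jumpNbhd`). Collapsing it leaves the two triangles of `N(w)` on the edge
`{w + t, w - t}`. As `4t = 0`, this edge has the form `{v, v + 2t}`, and the surviving triangles
regroup in fours: the facets of `{v, v + 2t, v + (s + t), v + (s + t) + 2t}` come from four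
different neighborhoods (`mem_collapsedNeighborhoodComplex_univ_iff`). Adding `s + t` to `v` leads
to the next tetrahedron, which shares an edge with the previous one. So each coset of `⟨2t, s + t⟩`
carries a closed cycle of hollow tetrahedra, whose length `m` is the order of `s + t` modulo `⟨2t⟩`;
the conditions on `3s` and `2s` rule out `m ≤ 3` (`four_le_jumpLength`).

Topology. The cosets cut the realization into its connected components. On a component, transferring
the common mass of `w ± s` to `w ± t` is a deformation retraction onto the cycle of hollow
tetrahedra (`nonempty_homotopyEquiv_cosetRealization`). It remains to shrink the disjoint gluing
edges to points. In the coordinates (mass, position) on these edges, the shrinking is an explicit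
map onto a union of boundaries of convex bodies, and it is a homotopy equivalence because some
homotopy of the source respects its fibers and finally contracts them
(`nonempty_homotopyEquiv_iUnion_pinchedSphere`). -/

/-! ### Quotient maps that are homotopy equivalences -/

section QuotientHomotopy

open unitInterval

/-- If a continuous surjection `f` from a compact space to a Hausdorff space is such that some
homotopy from the identity respects the fibers of `f` and ends with a map that is constant on
them, then `f` is a homotopy equivalence. -/
theorem nonempty_homotopyEquiv_of_fiberwise_homotopy {X Y : Type*} [TopologicalSpace X]
    [TopologicalSpace Y] [CompactSpace X] [T2Space Y] (f : C(X, Y)) (hf : Function.Surjective f)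
    (H : C(I × X, X)) (H_zero : ∀ x, H (0, x) = x)
    (H_one : ∀ x y, f x = f y → H (1, x) = H (1, y))
    (H_fiber : ∀ t x y, f x = f y → f (H (t, x)) = f (H (t, y))) :
    Nonempty (ContinuousMap.HomotopyEquiv X Y) := by
  -- A continuous surjection from a compact to a Hausdorff space is a quotient map. This applies to
  -- `f` and to `id × f`, so the end of `H` descends to a homotopy inverse `g`, and `f ∘ H` descends
  -- to a homotopy on `Y`.
  have hq : IsQuotientMap f := .of_surjective_continuous hf f.continuous
  let F : C(I × X, I × Y) := (ContinuousMap.id I).prodMap f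
  have hF : IsQuotientMap F :=
    .of_surjective_continuous (Function.surjective_id.prodMap hf) F.continuous
  let H₁ : C(X, X) := H.comp ((ContinuousMap.const X 1).prodMk (ContinuousMap.id X))
  let g : C(Y, X) := hq.lift H₁ fun x y h => H_one x y h
  have hg : ∀ x, g (f x) = H (1, x) := fun x =>
    DFunLike.congr_fun (hq.lift_comp H₁ fun x y h => H_one x y h) x
  have hfac : Function.FactorsThrough (f.comp H) F := by
    rintro ⟨t, x⟩ ⟨t', y⟩ h
    obtain ⟨rfl, h⟩ := Prod.ext_iff.1 h
    exact H_fiber _ x y h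
  let K : C(I × Y, Y) := hF.lift (f.comp H) hfac
  have hK : ∀ t x, K (t, f x) = f (H (t, x)) := fun t x =>
    DFunLike.congr_fun (hF.lift_comp (f.comp H) hfac) (t, x)
  refine ⟨⟨f, g, ContinuousMap.Homotopic.symm ⟨⟨H, H_zero, fun x => (hg x).symm⟩⟩,
    ContinuousMap.Homotopic.symm ⟨⟨K, fun y => ?_, fun y => ?_⟩⟩⟩⟩
  · obtain ⟨x, rfl⟩ := hf y
    exact (hK 0 x).trans (by simp [H_zero])
  · obtain ⟨x, rfl⟩ := hf y
    exact (hK 1 x).trans (by simp [hg])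

end QuotientHomotopy

/-! ### A convex body that models a pinched tetrahedron -/

section LensSphere

/-- The convex body in `ℝ³` whose slice at height `x 0 = l` is the square `[-l(1-l), l(1-l)]²`. -/
def squareLens : Set (EuclideanSpace ℝ (Fin 3)) :=
  {x | max |x 1| |x 2| ≤ x 0 * (1 - x 0)}

/-- The left side of the defining inequality is convex and `l(1-l)` is concave. -/
theorem convex_squareLens : Convex ℝ squareLens := by
  intro x hx y hy a b ha hb hab
  simp only [squareLens, Set.mem_ofPred_eq, max_le_iff, abs_le, PiLp.add_apply, PiLp.smul_apply,
    smul_eq_mul] at hx hy ⊢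
  obtain rfl : b = 1 - a := by linarith
  have key : a * (x 0 * (1 - x 0)) + (1 - a) * (y 0 * (1 - y 0)) ≤
      (a * x 0 + (1 - a) * y 0) * (1 - (a * x 0 + (1 - a) * y 0)) := by
    nlinarith [mul_nonneg (mul_nonneg ha hb) (sq_nonneg (x 0 - y 0))]
  obtain ⟨⟨h1, h2⟩, h3, h4⟩ := hx
  obtain ⟨⟨h5, h6⟩, h7, h8⟩ := hy
  refine ⟨⟨?_, ?_⟩, ?_, ?_⟩
  · linarith [mul_le_mul_of_nonneg_left h1 ha, mul_le_mul_of_nonneg_left h5 hb]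
  · linarith [mul_le_mul_of_nonneg_left h2 ha, mul_le_mul_of_nonneg_left h6 hb]
  · linarith [mul_le_mul_of_nonneg_left h3 ha, mul_le_mul_of_nonneg_left h7 hb]
  · linarith [mul_le_mul_of_nonneg_left h4 ha, mul_le_mul_of_nonneg_left h8 hb]

theorem isClosed_squareLens : IsClosed squareLens :=
  isClosed_le (by fun_prop) (by fun_prop)

theorem isOpen_squareLens_lt :
    IsOpen {x : EuclideanSpace ℝ (Fin 3) | max |x 1| |x 2| < x 0 * (1 - x 0)} :=
  isOpen_lt (by fun_prop) (by fun_prop)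

theorem mem_Icc_of_mem_squareLens {x : EuclideanSpace ℝ (Fin 3)} (hx : x ∈ squareLens) :
    0 ≤ x 0 ∧ x 0 ≤ 1 := by
  have h : 0 ≤ x 0 * (1 - x 0) := (abs_nonneg _).trans ((le_max_left _ _).trans hx)
  constructor <;> nlinarith

theorem isBounded_squareLens : Bornology.IsBounded squareLens := by
  refine (Metric.isBounded_iff_subset_closedBall 0).2 ⟨2, fun x hx => ?_⟩
  obtain ⟨h0, h1⟩ := mem_Icc_of_mem_squareLens hx
  have h2 : x 0 * (1 - x 0) ≤ 1 := by nlinarith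
  have hA : |x 1| ≤ 1 := (le_max_left _ _).trans (hx.trans h2)
  have hB : |x 2| ≤ 1 := (le_max_right _ _).trans (hx.trans h2)
  rw [mem_closedBall_zero_iff, EuclideanSpace.norm_eq, Real.sqrt_le_left (by norm_num),
    Fin.sum_univ_three]
  simp only [Real.norm_eq_abs, sq_abs]
  nlinarith [sq_le_one_iff_abs_le_one (x 1) |>.2 hA, sq_le_one_iff_abs_le_one (x 2) |>.2 hB]

/-- Moving a point of equality away from the center `(1/2, 0, 0)` by a factor `1 + r` multiplies the
left side by `1 + r` and does not increase the right side. At least one of the changes is strict, so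
the point leaves the body. -/
theorem interior_squareLens :
    interior squareLens = {x | max |x 1| |x 2| < x 0 * (1 - x 0)} := by
  refine subset_antisymm (fun x hx => ?_) (interior_maximal ?_ isOpen_squareLens_lt)
  · have hcont : Filter.Tendsto
        (fun r : ℝ => x + r • (x - (!₂[1 / 2, 0, 0] : EuclideanSpace ℝ (Fin 3)))) (𝓝[>] 0)
        (𝓝 x) := by
      refine Filter.Tendsto.mono_left ?_ nhdsWithin_le_nhds
      refine Continuous.tendsto' (by fun_prop) _ _ (by simp)
    obtain ⟨r, hr, hr0⟩ := ((hcont.eventually (isOpen_interior.mem_nhds hx)).and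
      self_mem_nhdsWithin).exists
    replace hr := interior_subset hr
    have hr0 : 0 < r := hr0
    have hx_mem : x ∈ squareLens := interior_subset hx
    refine lt_of_le_of_ne (Set.mem_ofPred.1 hx_mem) fun heq => ?_
    have key : max |x 1 + r * x 1| |x 2 + r * x 2| ≤
        (x 0 + r * (x 0 - 1 / 2)) * (1 - (x 0 + r * (x 0 - 1 / 2))) := by
      simpa [squareLens] using hr
    have hmax : max |x 1 + r * x 1| |x 2 + r * x 2| = (1 + r) * max |x 1| |x 2| := by
      rw [← one_add_mul, ← one_add_mul, abs_mul, abs_mul, abs_of_pos (by linarith : 0 < 1 + r),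
        mul_max_of_nonneg _ _ (by linarith)]
    rw [hmax, heq] at key
    nlinarith [mul_nonneg hr0.le (sq_nonneg (x 0 - 1 / 2)),
      mul_nonneg (mul_nonneg hr0.le hr0.le) (sq_nonneg (x 0 - 1 / 2))]
  · intro x hx
    exact (Set.mem_ofPred.1 hx).le

theorem frontier_squareLens :
    frontier squareLens = {x | max |x 1| |x 2| = x 0 * (1 - x 0)} := by
  rw [isClosed_squareLens.frontier_eq, interior_squareLens]
  ext x
  simp only [squareLens, Set.mem_sdiff, Set.mem_ofPred_eq, not_lt]
  exact ⟨fun h => le_antisymm h.1 h.2, fun h => ⟨h.le, h.ge⟩⟩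

theorem nonempty_frontier_squareLens_homeomorph_sphere :
    Nonempty (frontier squareLens ≃ₜ Metric.sphere (0 : EuclideanSpace ℝ (Fin 3)) 1) := by
  obtain ⟨e, -, -, he⟩ := exists_homeomorph_image_interior_closure_frontier_eq_unitBall
    convex_squareLens ⟨!₂[1 / 2, 0, 0], by
      rw [interior_squareLens]; simp [Set.mem_ofPred_eq]; norm_num⟩
    isBounded_squareLens
  exact ⟨(e.image _).trans (Homeomorph.setCongr he)⟩

end LensSphere

/-! ### Deformation of mass and position on one edge -/

section EdgeDeformation

open unitInterval

/-- The piecewise linear self-map of `[0, 1]` that collapses `[0, 1/3]` and `[2/3, 1]`. -/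
noncomputable def stretch (r : ℝ) : ℝ := max 0 (min 1 (3 * r - 1))

/-- The piecewise linear function on `[0, 1]` that vanishes up to `2/3` and is `1` at `1`. -/
noncomputable def slide (r : ℝ) : ℝ := max 0 (min 1 (3 * r - 2))

theorem stretch_nonneg (r : ℝ) : 0 ≤ stretch r := le_max_left _ _

theorem slide_nonneg (r : ℝ) : 0 ≤ slide r := le_max_left _ _

theorem slide_le_one (r : ℝ) : slide r ≤ 1 := max_le zero_le_one (min_le_left _ _)

theorem stretch_of_le {r : ℝ} (hr : r ≤ 1 / 3) : stretch r = 0 :=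
  max_eq_left ((min_le_right _ _).trans (by linarith))

theorem slide_of_le {r : ℝ} (hr : r ≤ 2 / 3) : slide r = 0 :=
  max_eq_left ((min_le_right _ _).trans (by linarith))

theorem stretch_one : stretch 1 = 1 := by norm_num [stretch]

theorem slide_one : slide 1 = 1 := by norm_num [slide]

/-- By the symmetry of `stretch` about `1/2`, the masses on two opposite edges of a tetrahedron
still add up to `1` after stretching. -/
theorem stretch_add_stretch {a b : ℝ} (h : a + b = 1) : stretch a + stretch b = 1 := by
  obtain rfl : b = 1 - a := by linarith
  unfold stretch
  rcases max_cases 0 (min 1 (3 * a - 1)) with h1 | h1 <;>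
  rcases max_cases 0 (min 1 (3 * (1 - a) - 1)) with h2 | h2 <;>
  rcases min_cases 1 (3 * a - 1) with h3 | h3 <;>
  rcases min_cases 1 (3 * (1 - a) - 1) with h4 | h4 <;> linarith

theorem continuous_stretch : Continuous stretch := by unfold stretch; fun_prop

theorem continuous_slide : Continuous slide := by unfold slide; fun_prop

/-- A deformation of the pair (mass, position) of a point relative to an edge: during the first
half of the time the mass is stretched, during the second half the position is moved to the
midpoint where the mass is large. -/
noncomputable def edgeDeform (t : ℝ) (p : ℝ × ℝ) : ℝ × ℝ :=
  ((1 - min (2 * t) 1) * p.1 + min (2 * t) 1 * stretch p.1,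
    p.2 * ((1 - min (2 * t) 1) + min (2 * t) 1 * stretch p.1 / max p.1 (1 / 3)) *
      (1 - max (2 * t - 1) 0 * slide p.1))

theorem continuous_edgeDeform : Continuous fun x : ℝ × ℝ × ℝ => edgeDeform x.1 x.2 := by
  have h1 := continuous_stretch
  have h2 := continuous_slide
  have h3 : Continuous fun x : ℝ × ℝ × ℝ =>
      min (2 * x.1) 1 * stretch x.2.1 / max x.2.1 (1 / 3) :=
    Continuous.div (by fun_prop) (by fun_prop) fun x => by positivity
  unfold edgeDeform
  fun_prop

theorem edgeDeform_zero_left (p : ℝ × ℝ) : edgeDeform 0 p = p := by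
  simp [edgeDeform]

theorem edgeDeform_zero_right (t : ℝ) : edgeDeform t 0 = 0 := by
  simp [edgeDeform, stretch_of_le]

theorem edgeDeform_fst_add {t : ℝ} {p q : ℝ × ℝ} (h : p.1 + q.1 = 1) :
    (edgeDeform t p).1 + (edgeDeform t q).1 = 1 := by
  have := stretch_add_stretch h
  simp only [edgeDeform]
  linear_combination (1 - min (2 * t) 1) * h + min (2 * t) 1 * this

/-- Stretching scales mass and position by the same factor, so it preserves their ratio. The `max`
with `1/3` avoids division by zero and changes nothing, since `stretch` vanishes up to `1/3`. -/
theorem edgeDeform_fst_eq {t : ℝ} {p : ℝ × ℝ} :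
    (edgeDeform t p).1 =
      p.1 * ((1 - min (2 * t) 1) + min (2 * t) 1 * stretch p.1 / max p.1 (1 / 3)) := by
  simp only [edgeDeform]
  rcases le_total p.1 (1 / 3) with h | h
  · rw [stretch_of_le h]; ring
  · rw [max_eq_left h]
    field_simp [(by linarith : p.1 ≠ 0)]

theorem edgeDeform_factor_nonneg {t : ℝ} (ht : t ∈ I) (r : ℝ) :
    0 ≤ (1 - min (2 * t) 1) + min (2 * t) 1 * stretch r / max r (1 / 3) := by
  have h1 : min (2 * t) 1 ≤ 1 := min_le_right _ _
  have h0 : 0 ≤ min (2 * t) 1 := le_min (by linarith [ht.1]) zero_le_one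
  have := stretch_nonneg r
  have : 0 ≤ min (2 * t) 1 * stretch r / max r (1 / 3) := by positivity
  linarith

theorem abs_edgeDeform_snd_le {t : ℝ} (ht : t ∈ I) {p : ℝ × ℝ} (hp : |p.2| ≤ p.1) :
    |(edgeDeform t p).2| ≤ (edgeDeform t p).1 := by
  have hp0 : 0 ≤ p.1 := (abs_nonneg _).trans hp
  have hf := edgeDeform_factor_nonneg ht p.1
  have hs : 0 ≤ 1 - max (2 * t - 1) 0 * slide p.1 := by
    have : max (2 * t - 1) 0 ≤ 1 := max_le (by linarith [ht.2]) zero_le_one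
    nlinarith [slide_nonneg p.1, slide_le_one p.1, le_max_right (2 * t - 1) 0]
  have hs1 : 1 - max (2 * t - 1) 0 * slide p.1 ≤ 1 := by
    nlinarith [slide_nonneg p.1, le_max_right (2 * t - 1) 0]
  rw [edgeDeform_fst_eq]
  simp only [edgeDeform]
  rw [abs_mul, abs_mul, abs_of_nonneg hf, abs_of_nonneg hs]
  exact (mul_le_of_le_one_right (by positivity) hs1).trans
    (mul_le_mul_of_nonneg_right hp hf)

theorem abs_edgeDeform_snd_eq {t : ℝ} (ht : t ∈ I) {p : ℝ × ℝ} (hp : |p.2| = p.1)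
    (h : t ≤ 1 / 2 ∨ p.1 ≤ 2 / 3) : |(edgeDeform t p).2| = (edgeDeform t p).1 := by
  have hf := edgeDeform_factor_nonneg ht p.1
  have hs : 1 - max (2 * t - 1) 0 * slide p.1 = 1 := by
    rcases h with h | h
    · rw [max_eq_right (by linarith)]; ring
    · rw [slide_of_le h]; ring
  rw [edgeDeform_fst_eq]
  simp only [edgeDeform]
  rw [hs, mul_one, abs_mul, abs_of_nonneg hf, hp]

theorem edgeDeform_of_le {t : ℝ} (ht : 1 / 2 ≤ t) {p : ℝ × ℝ} (hp : p.1 ≤ 1 / 3) :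
    edgeDeform t p = 0 := by
  simp [edgeDeform, stretch_of_le hp, min_eq_right (by linarith : 1 ≤ 2 * t)]

/-- The deformation can destroy the equality on the edge of `p` only after time `1/2` and at mass
above `2/3`. Then the opposite edge has mass below `1/3`, which has already been squashed to `0`, so
equality holds trivially there. Hence the deformation never enters the interior of the tetrahedron.
-/
theorem edgeDeform_snd_of_half_le {t : ℝ} (ht : t ∈ I) {p q : ℝ × ℝ} (h : p.1 + q.1 = 1)
    (hp : |p.2| = p.1) : |(edgeDeform t p).2| = (edgeDeform t p).1 ∨
      |(edgeDeform t q).2| = (edgeDeform t q).1 := by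
  by_cases h1 : t ≤ 1 / 2 ∨ p.1 ≤ 2 / 3
  · exact Or.inl (abs_edgeDeform_snd_eq ht hp h1)
  · push Not at h1
    rw [edgeDeform_of_le h1.1.le (by linarith : q.1 ≤ 1 / 3)]
    simp

/-- Reparametrization of the position along an edge, so that an edge of full mass becomes a
point. -/
def edgePinch (p : ℝ × ℝ) : ℝ × ℝ := (p.1, p.2 * (1 - p.1))

theorem edgePinch_zero : edgePinch 0 = 0 := by simp [edgePinch]

/-- The pinch forgets the position only at mass `1`, and there `slide 1 = 1` has moved it to the
midpoint. -/
theorem edgeDeform_one_eq_of_edgePinch_eq {p q : ℝ × ℝ} (h : edgePinch p = edgePinch q) :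
    edgeDeform 1 p = edgeDeform 1 q := by
  obtain ⟨a, b⟩ := p
  obtain ⟨a', b'⟩ := q
  obtain ⟨ha', h⟩ := Prod.ext_iff.1 h
  simp only [edgePinch] at h ha'
  subst ha'
  rcases eq_or_ne a 1 with rfl | ha
  · norm_num [edgeDeform, slide_one]
  · rw [mul_right_cancel₀ (sub_ne_zero.2 ha.symm) h]

/-- Mass `1` stays `1` at all times because `stretch 1 = 1`, so the pinch still kills the position.
-/
theorem edgePinch_edgeDeform_eq {t : ℝ} {p q : ℝ × ℝ} (h : edgePinch p = edgePinch q) :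
    edgePinch (edgeDeform t p) = edgePinch (edgeDeform t q) := by
  obtain ⟨a, b⟩ := p
  obtain ⟨a', b'⟩ := q
  obtain ⟨ha', h⟩ := Prod.ext_iff.1 h
  simp only [edgePinch] at h ha'
  subst ha'
  rcases eq_or_ne a 1 with rfl | ha
  · simp [edgePinch, edgeDeform, stretch_one]
  · rw [mul_right_cancel₀ (sub_ne_zero.2 ha.symm) h]

end EdgeDeformation

/-! ### Hollow tetrahedra and pinched spheres in edge coordinates -/

section Model

open unitInterval

variable {m : ℕ}

/-- The boundary of the `i`-th tetrahedron in a cycle of tetrahedra glued along edges, in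
coordinates (mass on the edge, position along the edge) for the gluing edges. -/
def tetraBoundary (i : ZMod m) : Set (ZMod m → ℝ × ℝ) :=
  {z | (∀ j, j ≠ i → j ≠ i + 1 → z j = 0) ∧ (z i).1 + (z (i + 1)).1 = 1 ∧
    |(z i).2| ≤ (z i).1 ∧ |(z (i + 1)).2| ≤ (z (i + 1)).1 ∧
    (|(z i).2| = (z i).1 ∨ |(z (i + 1)).2| = (z (i + 1)).1)}

/-- The image of `tetraBoundary i` when the gluing edges are shrunk to points. -/
def pinchedSphere (i : ZMod m) : Set (ZMod m → ℝ × ℝ) :=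
  {z | (∀ j, j ≠ i → j ≠ i + 1 → z j = 0) ∧ (z i).1 + (z (i + 1)).1 = 1 ∧
    max |(z i).2| |(z (i + 1)).2| = (z (i + 1)).1 * (z i).1}

theorem isClosed_tetraBoundary (i : ZMod m) : IsClosed (tetraBoundary i) := by
  simp only [tetraBoundary, Set.ofPred_and, Set.ofPred_or, Set.ofPred_forall]
  refine IsClosed.inter (isClosed_iInter fun j => isClosed_iInter fun _ => isClosed_iInter
    fun _ => isClosed_eq (by fun_prop) (by fun_prop)) (IsClosed.inter ?_ (IsClosed.inter ?_
      (IsClosed.inter ?_ (IsClosed.union ?_ ?_))))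
  · exact isClosed_eq (by fun_prop) (by fun_prop)
  · exact isClosed_le (by fun_prop) (by fun_prop)
  · exact isClosed_le (by fun_prop) (by fun_prop)
  · exact isClosed_eq (by fun_prop) (by fun_prop)
  · exact isClosed_eq (by fun_prop) (by fun_prop)

theorem isClosed_pinchedSphere (i : ZMod m) : IsClosed (pinchedSphere i) := by
  simp only [pinchedSphere, Set.ofPred_and, Set.ofPred_forall]
  exact IsClosed.inter (isClosed_iInter fun j => isClosed_iInter fun _ => isClosed_iInter
    fun _ => isClosed_eq (by fun_prop) (by fun_prop)) (IsClosed.inter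
      (isClosed_eq (by fun_prop) (by fun_prop)) (isClosed_eq (by fun_prop) (by fun_prop)))

theorem isCompact_tetraBoundary (i : ZMod m) : IsCompact (tetraBoundary i) := by
  refine (isCompact_univ_pi (X := fun _ : ZMod m => ℝ × ℝ) fun _ =>
    (isCompact_Icc (a := (0 : ℝ)) (b := 1)).prod (isCompact_Icc (a := (-1 : ℝ)) (b := 1))
    ).of_isClosed_subset (isClosed_tetraBoundary i) ?_
  rintro z ⟨h0, h1, h2, h3, -⟩ j -
  have h4 := (abs_nonneg _).trans h2
  have h5 := (abs_nonneg _).trans h3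
  have h6 := abs_le.1 (h2.trans (by linarith : _ ≤ (1 : ℝ)))
  have h7 := abs_le.1 (h3.trans (by linarith : _ ≤ (1 : ℝ)))
  rcases eq_or_ne j i with rfl | hi
  · exact ⟨⟨h4, by linarith⟩, h6⟩
  rcases eq_or_ne j (i + 1) with rfl | hi'
  · exact ⟨⟨h5, by linarith⟩, h7⟩
  · rw [h0 j hi hi']
    exact ⟨⟨le_rfl, zero_le_one⟩, by norm_num, zero_le_one⟩

theorem comp_edgeDeform_mem_tetraBoundary {t : ℝ} (ht : t ∈ I) {i : ZMod m}
    {z : ZMod m → ℝ × ℝ} (hz : z ∈ tetraBoundary i) :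
    (fun j => edgeDeform t (z j)) ∈ tetraBoundary i := by
  obtain ⟨h0, h1, h2, h3, h4⟩ := hz
  refine ⟨fun j hj hj' => ?_, edgeDeform_fst_add h1, abs_edgeDeform_snd_le ht h2,
    abs_edgeDeform_snd_le ht h3, ?_⟩
  · simp only [h0 j hj hj', edgeDeform_zero_right]
  · rcases h4 with h4 | h4
    · exact edgeDeform_snd_of_half_le ht h1 h4
    · exact (edgeDeform_snd_of_half_le ht ((add_comm _ _).trans h1) h4).symm

/-- The pinch multiplies the position on each edge by the mass on the opposite edge. Thus
`|position| ≤ mass` becomes a bound by the product of the two masses, attained on at least one edge.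
-/
theorem image_tetraBoundary [Fact (1 < m)] (i : ZMod m) :
    (fun (z : ZMod m → ℝ × ℝ) j => edgePinch (z j)) '' tetraBoundary i = pinchedSphere i := by
  have hi : i + 1 ≠ i := by simp
  ext w
  constructor
  · rintro ⟨z, ⟨h0, h1, h2, h3, h4⟩, rfl⟩
    have h5 := (abs_nonneg _).trans h2
    have h6 := (abs_nonneg _).trans h3
    refine ⟨fun j hj hj' => by simp only [h0 j hj hj', edgePinch_zero], h1, ?_⟩
    simp only [edgePinch]
    rw [show 1 - (z i).1 = (z (i + 1)).1 by linarith, show 1 - (z (i + 1)).1 = (z i).1 by linarith,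
      abs_mul, abs_mul, abs_of_nonneg h5, abs_of_nonneg h6]
    rcases h4 with h4 | h4
    · rw [h4, max_eq_left]
      · ring
      · nlinarith
    · rw [h4, max_eq_right]
      nlinarith
  · rintro ⟨h0, h1, h2⟩
    have hpos : 0 ≤ (w (i + 1)).1 * (w i).1 := h2 ▸ (abs_nonneg _).trans (le_max_left _ _)
    have h5 : 0 ≤ (w i).1 := by nlinarith
    have h6 : 0 ≤ (w (i + 1)).1 := by nlinarith
    have hA : |(w i).2| ≤ (w (i + 1)).1 * (w i).1 := h2 ▸ le_max_left _ _
    have hB : |(w (i + 1)).2| ≤ (w (i + 1)).1 * (w i).1 := h2 ▸ le_max_right _ _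
    have e1 : 1 - (w i).1 = (w (i + 1)).1 := by linarith
    have e2 : 1 - (w (i + 1)).1 = (w i).1 := by linarith
    -- Undo the pinch. At mass `1` the quotient is `0` by convention, which is harmless because the
    -- pinched position is `0` there.
    refine ⟨fun j => ((w j).1, (w j).2 / (1 - (w j).1)), ⟨fun j hj hj' => ?_, h1, ?_, ?_, ?_⟩, ?_⟩
    · simp [h0 j hj hj']
    · simp only [e1, abs_div, abs_of_nonneg h6]
      exact div_le_of_le_mul₀ h6 h5 (hA.trans_eq (mul_comm _ _))
    · simp only [e2, abs_div, abs_of_nonneg h5]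
      exact div_le_of_le_mul₀ h5 h6 hB
    · simp only [e1, e2, abs_div, abs_of_nonneg h6, abs_of_nonneg h5]
      rcases h6.eq_or_lt with h7 | h7
      · right
        simp only [← h7, zero_mul, abs_nonpos_iff] at hB ⊢
        simp [hB]
      rcases h5.eq_or_lt with h8 | h8
      · left
        simp only [← h8, mul_zero, abs_nonpos_iff] at hA ⊢
        simp [hA]
      rcases max_choice |(w i).2| |(w (i + 1)).2| with h9 | h9
      · left
        rw [← h9, h2]; field_simp
      · right
        rw [← h9, h2]; field_simp
    · funext j
      refine Prod.ext rfl ?_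
      simp only [edgePinch]
      refine div_mul_cancel_of_imp fun h => ?_
      have hj : (w j).1 = 1 := by linarith
      rcases eq_or_ne j i with rfl | hji
      · have : (w (j + 1)).1 = 0 := by linarith
        simpa [this] using hA
      rcases eq_or_ne j (i + 1) with rfl | hji'
      · have : (w i).1 = 0 := by linarith
        simpa [this] using hB
      · simp [h0 j hji hji']

/-- `pinchedSphere i` is the boundary of a convex body. -/
def frontierSquareLensHomeomorph [Fact (1 < m)] (i : ZMod m) :
    frontier squareLens ≃ₜ pinchedSphere i where
  -- The height `x 0` serves as the mass on the edge `i + 1`.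
  toFun x := ⟨fun j => if j = i then (1 - x.1 0, x.1 1) else
    if j = i + 1 then (x.1 0, x.1 2) else 0, by
      obtain ⟨x, hx⟩ := x
      rw [frontier_squareLens] at hx
      refine ⟨fun j hj hj' => by simp [hj, hj'], by simp, ?_⟩
      simpa using hx⟩
  invFun z := ⟨!₂[(z.1 (i + 1)).1, (z.1 i).2, (z.1 (i + 1)).2], by
    obtain ⟨z, h0, h1, h2⟩ := z
    rw [frontier_squareLens]
    simpa [← h1] using h2⟩
  left_inv x := by
    ext j
    fin_cases j <;> simp
  right_inv z := by
    obtain ⟨z, h0, h1, h2⟩ := z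
    refine Subtype.ext (funext fun j => ?_)
    rcases eq_or_ne j i with rfl | hji
    · refine Prod.ext ?_ ?_ <;> simp [← h1]
    rcases eq_or_ne j (i + 1) with rfl | hji'
    · refine Prod.ext ?_ ?_ <;> simp
    · simp [hji, hji', h0 j hji hji']
  continuous_toFun := by
    refine Continuous.subtype_mk (continuous_pi fun j => ?_) _
    split_ifs <;> fun_prop
  continuous_invFun := by
    have hz : ∀ j, Continuous fun z : pinchedSphere i => z.1 j := fun j =>
      (continuous_apply j).comp continuous_subtype_val
    refine Continuous.subtype_mk ((PiLp.continuous_toLp 2 _).comp (continuous_pi fun j => ?_)) _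
    fin_cases j
    · exact (hz (i + 1)).fst
    · exact (hz i).snd
    · exact (hz (i + 1)).snd

/-- The `i`-th sphere has all its mass on the edges `i` and `i + 1`. A common point of adjacent
spheres has mass `1` on the shared edge, which forces position `0`; a common point of other spheres
would have total mass `0`. -/
theorem isGarland_pinchedSphere (hm : 4 ≤ m) :
    IsGarland (Y := (⋃ i : ZMod m, pinchedSphere i : Set (ZMod m → ℝ × ℝ))) m
      fun i => Subtype.val ⁻¹' pinchedSphere i := by
  have hcast : ∀ k : ℕ, 0 < k → k < m → (k : ZMod m) ≠ 0 := fun k h0 hk h =>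
    (Nat.le_of_dvd h0 ((ZMod.natCast_eq_zero_iff _ _).1 h)).not_gt hk
  have h1 : (1 : ZMod m) ≠ 0 := by exact_mod_cast hcast 1 (by omega) (by omega)
  have h2 : (1 + 1 : ZMod m) ≠ 0 := by exact_mod_cast hcast 2 (by omega) (by omega)
  have key : ∀ i : ZMod m, (Subtype.val ⁻¹' pinchedSphere i ∩
      Subtype.val ⁻¹' pinchedSphere (i + 1) :
      Set (⋃ i : ZMod m, pinchedSphere i : Set (ZMod m → ℝ × ℝ))).encard = 1 := by
    intro i
    have hp : (fun j => if j = i + 1 then ((1 : ℝ), (0 : ℝ)) else 0) ∈ pinchedSphere i :=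
      ⟨fun j _ hj => by simp [hj], by simp [h1], by simp [h1]⟩
    have hp' : (fun j => if j = i + 1 then ((1 : ℝ), (0 : ℝ)) else 0) ∈ pinchedSphere (i + 1) :=
      ⟨fun j hj _ => by simp [hj], by simp [h1], by simp [h1]⟩
    rw [Set.encard_eq_one]
    refine ⟨⟨_, Set.mem_iUnion.2 ⟨i, hp⟩⟩, Set.eq_singleton_iff_unique_mem.2 ⟨⟨hp, hp'⟩, ?_⟩⟩
    rintro ⟨z, hz⟩ ⟨hz', hz''⟩
    obtain ⟨h3, h4, h5⟩ : z ∈ pinchedSphere i := hz'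
    obtain ⟨h6, -, -⟩ : z ∈ pinchedSphere (i + 1) := hz''
    refine Subtype.ext (funext fun j => ?_)
    have hzi : z i = 0 := h6 i (by simpa using h1) (by simpa [add_assoc] using h2)
    change z j = if j = i + 1 then ((1 : ℝ), (0 : ℝ)) else 0
    split_ifs with hj
    · subst hj
      simp only [hzi, Prod.fst_zero, Prod.snd_zero, zero_add, mul_zero] at h4 h5
      have h7 := (le_max_right _ _).trans_eq h5
      exact Prod.ext h4 (abs_nonpos_iff.1 h7)
    · rcases eq_or_ne j i with rfl | hji
      · exact hzi
      · exact h3 j hji hj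
  refine ⟨by omega, fun i => (isClosed_pinchedSphere i).preimage continuous_subtype_val, ?_, ?_, ?_⟩
  · refine Set.eq_univ_of_forall fun z => ?_
    simpa using Set.mem_iUnion.1 z.2
  · rintro i j - (rfl | rfl)
    · exact key i
    · rw [Set.inter_comm]
      exact key j
  · intro i j hij hij'
    push Not at hij'
    refine Set.eq_empty_of_forall_notMem ?_
    rintro z ⟨⟨-, h4, -⟩, ⟨h6, -, -⟩⟩
    rw [h6 i hij hij'.2, h6 (i + 1) hij'.1.symm (by simpa using hij)] at h4
    simp at h4

theorem isSphereGarland_iUnion_pinchedSphere (hm : 4 ≤ m) :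
    IsSphereGarland m (⋃ i : ZMod m, pinchedSphere i : Set (ZMod m → ℝ × ℝ)) := by
  have : Fact (1 < m) := ⟨by omega⟩
  refine ⟨_, isGarland_pinchedSphere hm, fun i => ?_⟩
  obtain ⟨e⟩ := nonempty_frontier_squareLens_homeomorph_sphere
  let φ : (Subtype.val ⁻¹' pinchedSphere i :
      Set (⋃ i : ZMod m, pinchedSphere i : Set (ZMod m → ℝ × ℝ))) ≃ₜ pinchedSphere i :=
    { toFun := fun z => ⟨z.1.1, z.2⟩
      invFun := fun z => ⟨⟨z.1, Set.mem_iUnion.2 ⟨i, z.2⟩⟩, z.2⟩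
      left_inv := fun _ => rfl
      right_inv := fun _ => rfl
      continuous_toFun := by fun_prop
      continuous_invFun := by fun_prop }
  exact ⟨φ.trans ((frontierSquareLensHomeomorph i).symm.trans e)⟩

/-- Pinch and deformation act on each edge coordinate separately, by formulas independent of `i`, so
they automatically agree where the tetrahedra overlap. -/
theorem nonempty_homotopyEquiv_iUnion_pinchedSphere (hm : 4 ≤ m) :
    Nonempty (ContinuousMap.HomotopyEquiv (⋃ i : ZMod m, tetraBoundary i : Set (ZMod m → ℝ × ℝ))
      (⋃ i : ZMod m, pinchedSphere i : Set (ZMod m → ℝ × ℝ))) := by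
  have : Fact (1 < m) := ⟨by omega⟩
  have : NeZero m := ⟨by omega⟩
  have : CompactSpace (⋃ i : ZMod m, tetraBoundary i : Set (ZMod m → ℝ × ℝ)) :=
    isCompact_iff_compactSpace.1 (isCompact_iUnion isCompact_tetraBoundary)
  have hmaps : ∀ z ∈ (⋃ i : ZMod m, tetraBoundary i : Set (ZMod m → ℝ × ℝ)),
      (fun j => edgePinch (z j)) ∈ ⋃ i : ZMod m, pinchedSphere i := by
    intro z hz
    obtain ⟨i, hi⟩ := Set.mem_iUnion.1 hz
    exact Set.mem_iUnion.2 ⟨i, image_tetraBoundary i ▸ Set.mem_image_of_mem _ hi⟩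
  have hdef : ∀ (t : I), ∀ z ∈ (⋃ i : ZMod m, tetraBoundary i : Set (ZMod m → ℝ × ℝ)),
      (fun j => edgeDeform t (z j)) ∈ (⋃ i : ZMod m, tetraBoundary i) := by
    intro t z hz
    obtain ⟨i, hi⟩ := Set.mem_iUnion.1 hz
    exact Set.mem_iUnion.2 ⟨i, comp_edgeDeform_mem_tetraBoundary t.2 hi⟩
  have hcont : Continuous edgePinch := by unfold edgePinch; fun_prop
  have hz : ∀ j, Continuous
      fun z : (⋃ i : ZMod m, tetraBoundary i : Set (ZMod m → ℝ × ℝ)) => z.1 j := fun j =>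
    (continuous_apply j).comp continuous_subtype_val
  have hcont' := continuous_edgeDeform
  refine nonempty_homotopyEquiv_of_fiberwise_homotopy
    ⟨fun z => ⟨_, hmaps z.1 z.2⟩, Continuous.subtype_mk
      (continuous_pi fun j => hcont.comp (hz j)) _⟩ ?_
    ⟨fun x => ⟨_, hdef x.1 x.2.1 x.2.2⟩, Continuous.subtype_mk (continuous_pi fun j =>
      hcont'.comp (g := fun x : ℝ × ℝ × ℝ => edgeDeform x.1 x.2)
        (f := fun x : I × (⋃ i : ZMod m, tetraBoundary i : Set (ZMod m → ℝ × ℝ)) =>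
          ((x.1 : ℝ), x.2.1 j))
        ((continuous_subtype_val.comp continuous_fst).prodMk ((hz j).comp continuous_snd))) _⟩
    ?_ ?_ ?_
  · rintro ⟨w, hw⟩
    obtain ⟨i, hi⟩ := Set.mem_iUnion.1 hw
    rw [← image_tetraBoundary i] at hi
    obtain ⟨z, hz, rfl⟩ := hi
    exact ⟨⟨z, Set.mem_iUnion.2 ⟨i, hz⟩⟩, rfl⟩
  · intro z
    exact Subtype.ext (funext fun j => edgeDeform_zero_left _)
  · intro z w h
    exact Subtype.ext (funext fun j =>
      edgeDeform_one_eq_of_edgePinch_eq (congrFun (Subtype.ext_iff.1 h) j))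
  · intro t z w h
    exact Subtype.ext (funext fun j =>
      edgePinch_edgeDeform_eq (congrFun (Subtype.ext_iff.1 h) j))

end Model

/-! ### Realization of a cycle of tetrahedra boundaries -/

theorem PreAbstractSimplicialComplex.mem_iSup {V ι : Type*}
    {K : ι → PreAbstractSimplicialComplex V} {γ : Finset V} : γ ∈ ⨆ i, K i ↔ ∃ i, γ ∈ K i := by
  change γ ∈ ⋃ L ∈ Set.range K, L.faces ↔ _
  simp only [Set.mem_iUnion, Set.mem_range, exists_prop, exists_exists_eq_and]
  rfl

theorem mem_geometricRealization_iSup_simplexBoundary {V ι : Type*} [Fintype V] [DecidableEq V]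
    {Γ : ι → Finset V} {x : V → ℝ} :
    x ∈ geometricRealization (⨆ i, simplexBoundary (Γ i)) ↔
      x ∈ stdSimplex ℝ V ∧ ∃ i, (∀ v, x v ≠ 0 → v ∈ Γ i) ∧ ∃ v ∈ Γ i, x v = 0 := by
  refine and_congr_right fun hx => ⟨?_, ?_⟩
  · rintro ⟨σ, hσ, hxσ⟩
    obtain ⟨i, -, hi⟩ := PreAbstractSimplicialComplex.mem_iSup.1 hσ
    obtain ⟨v, hv, hv'⟩ := Finset.exists_of_ssubset hi
    exact ⟨i, fun w hw => hi.1 (hxσ w hw), v, hv, by_contra fun h => hv' (hxσ v h)⟩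
  · rintro ⟨i, hi, v, hv, hxv⟩
    refine ⟨(Γ i).erase v, PreAbstractSimplicialComplex.mem_iSup.2
      ⟨i, ?_, Finset.erase_ssubset hv⟩, fun w hw => Finset.mem_erase.2 ⟨?_, hi w hw⟩⟩
    · obtain ⟨w, hw⟩ : ∃ w, x w ≠ 0 := by
        by_contra! h
        simpa [h] using hx.2
      exact ⟨w, Finset.mem_erase.2 ⟨by rintro rfl; exact hw hxv, hi w hw⟩⟩
    · rintro rfl
      exact hw hxv

section EdgeCoordinates

variable {V : Type*} {m : ℕ}

/-- The coordinates (mass, position) of a point with respect to the edges `{p j, q j}`. -/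
def edgeCoords (p q : ZMod m → V) (x : V → ℝ) (j : ZMod m) : ℝ × ℝ :=
  (x (p j) + x (q j), x (p j) - x (q j))

theorem continuous_edgeCoords (p q : ZMod m → V) : Continuous (edgeCoords p q) := by
  unfold edgeCoords
  fun_prop

variable [DecidableEq V]

/-- The vertex set of the `i`-th tetrahedron in the cycle of tetrahedra glued along the edges
`{p j, q j}`. -/
def cycleTetra (p q : ZMod m → V) (i : ZMod m) : Finset V := {p i, q i, p (i + 1), q (i + 1)}

variable {p q : ZMod m → V}

theorem isTetrahedraCycle_iSup_simplexBoundary (hp : Function.Injective p)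
    (hq : Function.Injective q) (hpq : ∀ i j, p i ≠ q j) (hm : 4 ≤ m) :
    IsTetrahedraCycle m (⨆ i, simplexBoundary (cycleTetra p q i)) := by
  have : Fact (1 < m) := ⟨by omega⟩
  have hqp : ∀ i j, q i ≠ p j := fun i j => (hpq j i).symm
  have h2 : (1 + 1 : ZMod m) ≠ 0 := fun h =>
    (Nat.le_of_dvd two_pos ((ZMod.natCast_eq_zero_iff 2 m).1 (by push_cast; rw [← h]; ring))).not_gt
      (by omega)
  refine ⟨cycleTetra p q, fun i => ?_, fun i => ?_, fun i j h1 h2 h3 => ?_, rfl⟩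
  · rw [cycleTetra, Finset.card_insert_of_notMem, Finset.card_insert_of_notMem,
      Finset.card_insert_of_notMem, Finset.card_singleton] <;>
    simp [hp.eq_iff, hq.eq_iff, hpq, hqp]
  · have : cycleTetra p q i ∩ cycleTetra p q (i + 1) = {p (i + 1), q (i + 1)} := by
      ext v
      simp only [cycleTetra, Finset.mem_inter, Finset.mem_insert, Finset.mem_singleton]
      constructor
      · rintro ⟨rfl | rfl | rfl | rfl, h⟩ <;>
        simp [hp.eq_iff, hq.eq_iff, hpq, hqp, add_assoc, h2] at h ⊢
      · rintro (rfl | rfl) <;> simp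
    rw [this, Finset.card_pair (hpq _ _)]
  · rw [Finset.disjoint_left]
    intro v hv
    simp only [cycleTetra, Finset.mem_insert, Finset.mem_singleton] at hv ⊢
    rcases hv with rfl | rfl | rfl | rfl <;>
    simp [hp.eq_iff, hq.eq_iff, hpq, hqp, h1, h2.symm, h3]

theorem sum_eq_of_support_cycleTetra [Fintype V] (hp : Function.Injective p)
    (hq : Function.Injective q) (hpq : ∀ i j, p i ≠ q j) (hm : 1 < m) {x : V → ℝ} {i : ZMod m}
    (hx : ∀ v, x v ≠ 0 → v ∈ cycleTetra p q i) :
    ∑ v, x v = x (p i) + x (q i) + (x (p (i + 1)) + x (q (i + 1))) := by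
  have : Fact (1 < m) := ⟨hm⟩
  rw [← Finset.sum_subset (Finset.subset_univ (cycleTetra p q i))
    fun v _ hv => by_contra fun h => hv (hx v h), cycleTetra, Finset.sum_insert, Finset.sum_insert,
    Finset.sum_insert, Finset.sum_singleton]
  · ring
  · simpa using hpq _ _
  · simp [hq.eq_iff, fun i j => (hpq i j).symm]
  · simp [hp.eq_iff, hpq]

/-- For nonnegative barycentric coordinates, the sum over an edge equals the absolute difference
exactly when one endpoint has coordinate `0`. This is how the position records that a point lies on
a proper face. -/
theorem edgeCoords_mem_iUnion_tetraBoundary [Fintype V] (hp : Function.Injective p)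
    (hq : Function.Injective q) (hpq : ∀ i j, p i ≠ q j) (hm : 1 < m) {x : V → ℝ}
    (hx : x ∈ geometricRealization (⨆ i, simplexBoundary (cycleTetra p q i))) :
    edgeCoords p q x ∈ ⋃ i, tetraBoundary i := by
  obtain ⟨⟨hx0, hx1⟩, i, hi, v, hv, hxv⟩ :=
    mem_geometricRealization_iSup_simplexBoundary.1 hx
  refine Set.mem_iUnion.2 ⟨i, fun j hj hj' => ?_, ?_, ?_, ?_, ?_⟩
  · have h1 : x (p j) = 0 := by
      by_contra h
      simpa [cycleTetra, hp.eq_iff, hpq, hj, hj'] using hi _ h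
    have h2 : x (q j) = 0 := by
      by_contra h
      simpa [cycleTetra, hq.eq_iff, fun i j => (hpq i j).symm, hj, hj'] using hi _ h
    simp [edgeCoords, h1, h2]
  · rw [← hx1, sum_eq_of_support_cycleTetra hp hq hpq hm hi]
    rfl
  · exact abs_le.2 ⟨by simp only [edgeCoords]; linarith [hx0 (p i)],
      by simp only [edgeCoords]; linarith [hx0 (q i)]⟩
  · exact abs_le.2 ⟨by simp only [edgeCoords]; linarith [hx0 (p (i + 1))],
      by simp only [edgeCoords]; linarith [hx0 (q (i + 1))]⟩
  · simp only [cycleTetra, Finset.mem_insert, Finset.mem_singleton] at hv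
    simp only [edgeCoords]
    rcases hv with rfl | rfl | rfl | rfl
    · left; simp [hxv, abs_of_nonneg (hx0 _)]
    · left; simp [hxv, abs_of_nonneg (hx0 _)]
    · right; simp [hxv, abs_of_nonneg (hx0 _)]
    · right; simp [hxv, abs_of_nonneg (hx0 _)]

variable [NeZero m]

/-- The point with given coordinates (mass, position) with respect to the edges `{p j, q j}`. -/
noncomputable def ofEdgeCoords (p q : ZMod m → V) (z : ZMod m → ℝ × ℝ) (v : V) : ℝ :=
  ∑ j, ((if v = p j then ((z j).1 + (z j).2) / 2 else 0) +
    (if v = q j then ((z j).1 - (z j).2) / 2 else 0))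

theorem continuous_ofEdgeCoords (p q : ZMod m → V) : Continuous (ofEdgeCoords p q) := by
  unfold ofEdgeCoords
  refine continuous_pi fun v => continuous_finsetSum _ fun j _ => ?_
  split_ifs <;> fun_prop

theorem ofEdgeCoords_left (hp : Function.Injective p) (hpq : ∀ i j, p i ≠ q j)
    (z : ZMod m → ℝ × ℝ) (k : ZMod m) :
    ofEdgeCoords p q z (p k) = ((z k).1 + (z k).2) / 2 := by
  simp [ofEdgeCoords, hp.eq_iff, hpq]

theorem ofEdgeCoords_right (hq : Function.Injective q) (hpq : ∀ i j, p i ≠ q j)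
    (z : ZMod m → ℝ × ℝ) (k : ZMod m) :
    ofEdgeCoords p q z (q k) = ((z k).1 - (z k).2) / 2 := by
  simp [ofEdgeCoords, hq.eq_iff, fun i j => (hpq i j).symm]

theorem ofEdgeCoords_of_notMem {z : ZMod m → ℝ × ℝ} {v : V} (h : ∀ j, v ≠ p j ∧ v ≠ q j) :
    ofEdgeCoords p q z v = 0 :=
  Finset.sum_eq_zero fun j _ => by simp [h j]

variable [Fintype V]

theorem ofEdgeCoords_mem_geometricRealization (hp : Function.Injective p)
    (hq : Function.Injective q) (hpq : ∀ i j, p i ≠ q j) (hm : 1 < m) {z : ZMod m → ℝ × ℝ}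
    (hz : z ∈ ⋃ i, tetraBoundary i) : ofEdgeCoords p q z ∈
      geometricRealization (⨆ i, simplexBoundary (cycleTetra p q i)) := by
  obtain ⟨i, h0, h1, h2, h3, h4⟩ := Set.mem_iUnion.1 hz
  have hz0 : ∀ j, |(z j).2| ≤ (z j).1 := by
    intro j
    rcases eq_or_ne j i with rfl | hj
    · exact h2
    rcases eq_or_ne j (i + 1) with rfl | hj'
    · exact h3
    · simp [h0 j hj hj']
  have hL := ofEdgeCoords_left hp hpq z
  have hR := ofEdgeCoords_right hq hpq z
  have hsupp : ∀ v, ofEdgeCoords p q z v ≠ 0 → v ∈ cycleTetra p q i := by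
    intro v hv
    obtain ⟨j, hj⟩ : ∃ j, v = p j ∨ v = q j := by
      by_contra! h
      exact hv (ofEdgeCoords_of_notMem h)
    have hj' : z j ≠ 0 := by
      intro h
      rcases hj with rfl | rfl <;> simp [hL, hR, h] at hv
    have : j = i ∨ j = i + 1 := by
      by_contra! h
      exact hj' (h0 j h.1 h.2)
    rcases hj with rfl | rfl <;> rcases this with rfl | rfl <;> simp [cycleTetra]
  refine mem_geometricRealization_iSup_simplexBoundary.2 ⟨⟨fun v => ?_, ?_⟩, i, hsupp, ?_⟩
  · refine Finset.sum_nonneg fun j _ => ?_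
    have := abs_le.1 (hz0 j)
    refine add_nonneg ?_ ?_ <;> split_ifs <;> linarith
  · rw [sum_eq_of_support_cycleTetra hp hq hpq hm hsupp, hL, hL, hR, hR, ← h1]
    ring
  · have key : ∀ j, |(z j).2| = (z j).1 → ofEdgeCoords p q z (p j) = 0 ∨
        ofEdgeCoords p q z (q j) = 0 := by
      intro j hj
      rw [hL, hR]
      rcases abs_choice (z j).2 with h | h
      · right; linarith
      · left; linarith
    rcases h4 with h4 | h4 <;> rcases key _ h4 with h | h
    exacts [⟨_, by simp [cycleTetra], h⟩, ⟨_, by simp [cycleTetra], h⟩,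
      ⟨_, by simp [cycleTetra], h⟩, ⟨_, by simp [cycleTetra], h⟩]

/-- The realization of a cycle of tetrahedra boundaries, in edge coordinates. -/
noncomputable def realizationHomeomorph (hp : Function.Injective p)
    (hq : Function.Injective q) (hpq : ∀ i j, p i ≠ q j) (hm : 1 < m) :
    geometricRealization (⨆ i, simplexBoundary (cycleTetra p q i)) ≃ₜ
      (⋃ i : ZMod m, tetraBoundary i : Set (ZMod m → ℝ × ℝ)) where
  toFun x := ⟨edgeCoords p q x.1, edgeCoords_mem_iUnion_tetraBoundary hp hq hpq hm x.2⟩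
  invFun z := ⟨ofEdgeCoords p q z.1, ofEdgeCoords_mem_geometricRealization hp hq hpq hm z.2⟩
  left_inv x := by
    obtain ⟨x, hx⟩ := x
    refine Subtype.ext (funext fun v => ?_)
    change ofEdgeCoords p q (edgeCoords p q x) v = x v
    by_cases h : ∃ j, v = p j ∨ v = q j
    · obtain ⟨j, rfl | rfl⟩ := h
      · rw [ofEdgeCoords_left hp hpq]
        simp only [edgeCoords]; ring
      · rw [ofEdgeCoords_right hq hpq]
        simp only [edgeCoords]; ring
    · push Not at h
      rw [ofEdgeCoords_of_notMem h]
      obtain ⟨-, i, hi, -⟩ := mem_geometricRealization_iSup_simplexBoundary.1 hx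
      by_contra hv
      simpa [cycleTetra, h] using hi v (Ne.symm hv)
  right_inv z := by
    refine Subtype.ext (funext fun j => ?_)
    change edgeCoords p q (ofEdgeCoords p q z.1) j = z.1 j
    simp only [edgeCoords, ofEdgeCoords_left hp hpq, ofEdgeCoords_right hq hpq]
    exact Prod.ext (by ring) (by ring)
  continuous_toFun :=
    ((continuous_edgeCoords p q).comp continuous_subtype_val).subtype_mk _
  continuous_invFun :=
    ((continuous_ofEdgeCoords p q).comp continuous_subtype_val).subtype_mk _

theorem exists_sphereGarland_homotopyEquiv (hp : Function.Injective p)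
    (hq : Function.Injective q) (hpq : ∀ i j, p i ≠ q j) (hm : 4 ≤ m) :
    ∃ (Y : Type) (_ : TopologicalSpace Y), IsSphereGarland m Y ∧
      Nonempty (ContinuousMap.HomotopyEquiv
        (geometricRealization (⨆ i, simplexBoundary (cycleTetra p q i))) Y) := by
  obtain ⟨e⟩ := nonempty_homotopyEquiv_iUnion_pinchedSphere hm
  exact ⟨_, _, isSphereGarland_iUnion_pinchedSphere hm,
    ⟨(realizationHomeomorph hp hq hpq (by omega)).toHomotopyEquiv.trans e⟩⟩

end EdgeCoordinates

/-- The homotopy runs along the segment from `x` to `r x`; the other composition is the identity of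
`B`. -/
theorem nonempty_homotopyEquiv_of_retraction {E : Type*} [AddCommGroup E] [Module ℝ E]
    [TopologicalSpace E] [IsTopologicalAddGroup E] [ContinuousSMul ℝ E] {A B : Set E} {r : E → E}
    (hr : Continuous r) (hBA : B ⊆ A) (hrB : ∀ x ∈ A, r x ∈ B) (hfix : ∀ x ∈ B, r x = x)
    (hseg : ∀ x ∈ A, segment ℝ x (r x) ⊆ A) : Nonempty (ContinuousMap.HomotopyEquiv A B) := by
  let R : C(A, B) := ⟨fun x => ⟨r x.1, hrB x.1 x.2⟩, (hr.comp continuous_subtype_val).subtype_mk _⟩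
  let J : C(B, A) := ⟨fun x => ⟨x.1, hBA x.2⟩, continuous_subtype_val.subtype_mk _⟩
  refine ⟨⟨R, J, ContinuousMap.Homotopic.symm ⟨⟨⟨fun x =>
    ⟨AffineMap.lineMap x.2.1 (r x.2.1) (x.1 : ℝ),
    hseg x.2.1 x.2.2 ?_⟩, ?_⟩, fun x => ?_, fun x => ?_⟩⟩, ?_⟩⟩
  · rw [segment_eq_image_lineMap]
    exact Set.mem_image_of_mem _ x.1.2
  · refine Continuous.subtype_mk ?_ _
    simp only [AffineMap.lineMap_apply_module]
    have h1 : Continuous fun x : unitInterval × A => (x.2 : E) :=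
      continuous_subtype_val.comp continuous_snd
    have h2 : Continuous fun x : unitInterval × A => r x.2 := hr.comp h1
    fun_prop
  · exact Subtype.ext (by simp)
  · exact Subtype.ext (by simp [R, J])
  · have : R.comp J = ContinuousMap.id B :=
      ContinuousMap.ext fun x => Subtype.ext (hfix x.1 x.2)
    rw [this]

/-! ### Collapsing the neighborhood complex -/

section Circulant

variable {R : Type*} [CommRing R]

/-- The conditions on `s, t` (in `ℤ/n`) under which the neighborhood complex of the circulant
graph `C_n(s,t)` with `4t = n` is a disjoint union of garlands. -/
structure IsGarlandPair (s t : R) : Prop where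
  four_mul_right : 4 * t = 0
  two_mul_right : 2 * t ≠ 0
  two_mul_left : 2 * s ≠ 0
  four_mul_left : 4 * s ≠ 0
  two_mul_ne : 2 * s ≠ 2 * t
  three_mul_ne : 3 * s ≠ t
  three_mul_ne_neg : 3 * s ≠ -t

variable {s t : R}

/-- The neighborhood complex of the circulant graph without the simplices that contain
`{w + s, w - s}` for some `w ∈ S`. -/
def collapsedNeighborhoodComplex (s t : R) (S : Set R) : PreAbstractSimplicialComplex R where
  faces := {γ | γ ∈ neighborhoodComplex (SimpleGraph.circulantGraph {s, t}) ∧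
    ∀ w ∈ S, ¬ (w + s ∈ γ ∧ w - s ∈ γ)}
  isRelLowerSet_faces := by
    rintro γ ⟨hγ, hS⟩
    have h := PreAbstractSimplicialComplex.isRelLowerSet_faces _ hγ
    exact ⟨h.1, fun ρ hρ hρne => ⟨h.2 hρ hρne, fun w hw hρw => hS w hw ⟨hρ hρw.1, hρ hρw.2⟩⟩⟩

theorem mem_collapsedNeighborhoodComplex {S : Set R} {γ : Finset R} :
    γ ∈ collapsedNeighborhoodComplex s t S ↔
      γ ∈ neighborhoodComplex (SimpleGraph.circulantGraph {s, t}) ∧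
        ∀ w ∈ S, ¬ (w + s ∈ γ ∧ w - s ∈ γ) := Iff.rfl

variable [DecidableEq R]

/-- The neighborhood of `w` in the circulant graph with jumps `s` and `t`. -/
def jumpNbhd (s t w : R) : Finset R := {w + s, w - s, w + t, w - t}

theorem mem_jumpNbhd {w v : R} :
    v ∈ jumpNbhd s t w ↔ v = w + s ∨ v = w - s ∨ v = w + t ∨ v = w - t := by
  simp [jumpNbhd]

theorem circulantGraph_adj_iff_mem_jumpNbhd (h : IsGarlandPair s t) {w v : R} :
    (SimpleGraph.circulantGraph {s, t}).Adj w v ↔ v ∈ jumpNbhd s t w := by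
  have h1 := h.two_mul_left
  have h2 := h.two_mul_right
  simp only [SimpleGraph.circulantGraph_adj, mem_jumpNbhd, Set.mem_insert_iff,
    Set.mem_singleton_iff]
  grind

theorem mem_neighborhoodComplex_circulantGraph (h : IsGarlandPair s t) {γ : Finset R} :
    γ ∈ neighborhoodComplex (SimpleGraph.circulantGraph {s, t}) ↔
      γ.Nonempty ∧ ∃ w, γ ⊆ jumpNbhd s t w := by
  change (γ.Nonempty ∧ ∃ w, ∀ v ∈ γ, (SimpleGraph.circulantGraph {s, t}).Adj w v) ↔ _
  simp only [circulantGraph_adj_iff_mem_jumpNbhd h]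
  rfl

/-- The pair `{w + s, w - s}` is contained in no other neighborhood than that of `w`. -/
theorem eq_of_mem_jumpNbhd (h : IsGarlandPair s t) {w w' : R} (h₁ : w + s ∈ jumpNbhd s t w')
    (h₂ : w - s ∈ jumpNbhd s t w') : w = w' := by
  obtain ⟨g1, g2, g3, g4, g5, g6, g7⟩ := h
  rw [mem_jumpNbhd] at h₁ h₂
  rcases h₁ with h₁ | h₁ | h₁ | h₁ <;> rcases h₂ with h₂ | h₂ | h₂ | h₂ <;> grind

theorem card_jumpNbhd (h : IsGarlandPair s t) (w : R) : (jumpNbhd s t w).card = 4 := by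
  obtain ⟨g1, g2, g3, g4, g5, g6, g7⟩ := h
  rw [jumpNbhd, Finset.card_insert_of_notMem, Finset.card_insert_of_notMem,
    Finset.card_insert_of_notMem, Finset.card_singleton] <;>
  simp only [Finset.mem_insert, Finset.mem_singleton] <;> grind

/-- One collapse for each `w`, with free face `{w + s, w - s}` inside `jumpNbhd s t w`. Collapses at
other centers remove no face of `jumpNbhd s t w`, so the order is irrelevant. -/
theorem collapses_collapsedNeighborhoodComplex (h : IsGarlandPair s t) (S : Finset R) :
    Collapses (neighborhoodComplex (SimpleGraph.circulantGraph {s, t}))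
      (collapsedNeighborhoodComplex s t S) := by
  induction S using Finset.induction_on with
  | empty =>
    have : collapsedNeighborhoodComplex s t ((∅ : Finset R) : Set R) =
        neighborhoodComplex (SimpleGraph.circulantGraph {s, t}) :=
      SetLike.ext fun γ => by simp [mem_collapsedNeighborhoodComplex]
    rw [this]
    exact Relation.ReflTransGen.refl
  | insert w S hw ih =>
    refine ih.tail ?_
    have hmem : ∀ γ : Finset R, γ.Nonempty → γ ⊆ jumpNbhd s t w →
        γ ∈ collapsedNeighborhoodComplex s t S := by
      refine fun γ hne hγ => ⟨(mem_neighborhoodComplex_circulantGraph h).2 ⟨hne, w, hγ⟩, ?_⟩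
      rintro w' hw' ⟨h1, h2⟩
      exact hw (eq_of_mem_jumpNbhd h (hγ h1) (hγ h2) ▸ hw')
    have hpair : ∀ {γ : Finset R}, {w + s, w - s} ⊆ γ ↔ w + s ∈ γ ∧ w - s ∈ γ := by
      simp [Finset.insert_subset_iff]
    have hsub : ∀ γ ∈ collapsedNeighborhoodComplex s t S, w + s ∈ γ → w - s ∈ γ →
        γ ⊆ jumpNbhd s t w := by
      intro γ hγ h1 h2
      obtain ⟨-, w', hw'⟩ := (mem_neighborhoodComplex_circulantGraph h).1 hγ.1
      rwa [eq_of_mem_jumpNbhd h (hw' h1) (hw' h2)]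
    have hself := hmem (jumpNbhd s t w) ⟨w + s, by simp [mem_jumpNbhd]⟩ subset_rfl
    refine ⟨{w + s, w - s}, hmem _ (by simp) (hpair.2 (by simp [mem_jumpNbhd])),
      jumpNbhd s t w, ⟨hself, ?_⟩, ?_, ?_, ?_⟩
    · intro γ hγ hle
      exact hsub γ hγ (hle (by simp [mem_jumpNbhd])) (hle (by simp [mem_jumpNbhd]))
    · refine (hpair.2 (by simp [mem_jumpNbhd])).ssubset_of_ne fun heq => ?_
      have := card_jumpNbhd h w
      have h2 := Finset.card_le_two (a := w + s) (b := w - s)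
      rw [heq] at h2
      omega
    · intro ρ hρ hle
      obtain ⟨h1, h2⟩ := hpair.1 hle
      exact hρ.eq_of_le hself (hsub ρ hρ.1 h1 h2)
    · ext γ
      simp only [Set.mem_sdiff, Set.mem_ofPred]
      constructor
      · rintro ⟨hγ, hS⟩
        exact ⟨⟨hγ, fun w' hw' => hS w' (by simp [hw'])⟩, fun hγ' => hS w (by simp)
          (hpair.1 hγ'.1)⟩
      · rintro ⟨⟨hγ, hS⟩, hγ'⟩
        refine ⟨hγ, fun w' hw' h3 => ?_⟩
        rcases Finset.mem_insert.1 (Finset.mem_coe.1 hw') with rfl | hw'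
        · exact hγ' ⟨hpair.2 h3, hsub γ ⟨hγ, hS⟩ h3.1 h3.2⟩
        · exact hS w' hw' h3

/-- The vertex set of the tetrahedron that has the edges `{v, v + 2t}` and
`{v + (s + t), v + (s + t) + 2t}`. -/
def jumpTetra (s t v : R) : Finset R := {v, v + 2 * t, v + (s + t), v + (s + t) + 2 * t}

theorem mem_collapsedNeighborhoodComplex_univ_iff (h : IsGarlandPair s t) {γ : Finset R} :
    γ ∈ collapsedNeighborhoodComplex s t Set.univ ↔ ∃ v, γ ∈ simplexBoundary (jumpTetra s t v) := by
  constructor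
  · rintro ⟨hγ, hS⟩
    obtain ⟨hne, w, hw⟩ := (mem_neighborhoodComplex_circulantGraph h).1 hγ
    obtain ⟨g1, g2, g3, g4, g5, g6, g7⟩ := h
    by_cases hs : w + s ∈ γ
    · have hs' : w - s ∉ γ := fun h' => hS w trivial ⟨hs, h'⟩
      -- The face lies in `{w + s, w + t, w - t}`. As `4t = 0`, this is the facet opposite `w + s +
      -- 2t` of the tetrahedron at `w + t`.
      refine ⟨w + t, hne, (Finset.ssubset_iff_of_subset fun v hv => ?_).2
        ⟨w + t + (s + t), by simp [jumpTetra], fun h' => ?_⟩⟩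
      · have := mem_jumpNbhd.1 (hw hv)
        simp only [jumpTetra, Finset.mem_insert, Finset.mem_singleton]
        grind
      · have := mem_jumpNbhd.1 (hw h')
        grind
    -- Here the face lies in `{w - s, w + t, w - t}`, the facet opposite `w - s + 2t` of the
    -- tetrahedron at `w - s`.
    · refine ⟨w - s, hne, (Finset.ssubset_iff_of_subset fun v hv => ?_).2
        ⟨w - s + 2 * t, by simp [jumpTetra], fun h' => ?_⟩⟩
      · have := mem_jumpNbhd.1 (hw hv)
        simp only [jumpTetra, Finset.mem_insert, Finset.mem_singleton]
        grind
      · have := mem_jumpNbhd.1 (hw h')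
        grind
  · rintro ⟨v, hne, hγ⟩
    obtain ⟨x, hx, hxγ⟩ := Finset.exists_of_ssubset hγ
    have key : ∀ w, γ ⊆ jumpNbhd s t w → ¬ (w + s ∈ γ ∧ w - s ∈ γ) →
        γ ∈ collapsedNeighborhoodComplex s t Set.univ := by
      refine fun w hw hS => ⟨(mem_neighborhoodComplex_circulantGraph h).2 ⟨hne, w, hw⟩, ?_⟩
      intro w' _ hw'
      obtain rfl := eq_of_mem_jumpNbhd h (hw hw'.1) (hw hw'.2)
      exact hS hw'
    obtain ⟨g1, g2, g3, g4, g5, g6, g7⟩ := h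
    have hγ' : ∀ y ∈ γ, (y = v ∨ y = v + 2 * t ∨ y = v + (s + t) ∨ y = v + (s + t) + 2 * t) ∧
        y ≠ x := fun y hy => ⟨by simpa [jumpTetra] using hγ.1 hy, by rintro rfl; exact hxγ hy⟩
    simp only [jumpTetra, Finset.mem_insert, Finset.mem_singleton] at hx
    -- The facet opposite `x` contains the gluing edge that avoids `x`. The center `w` is chosen
    -- such that this edge is `{w + t, w - t}` and the third vertex is `w - s` (first two cases) or
    -- `w + s` (last two).
    rcases hx with rfl | rfl | rfl | rfl
    · refine key (x + s + 2 * t) (fun y hy => ?_) fun hy => ?_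
      · have := hγ' y hy
        rw [mem_jumpNbhd]
        grind
      · have h1 := hγ' _ hy.1
        have h2 := hγ' _ hy.2
        grind
    · refine key (v + s) (fun y hy => ?_) fun hy => ?_
      · have := hγ' y hy
        rw [mem_jumpNbhd]
        grind
      · have h1 := hγ' _ hy.1
        have h2 := hγ' _ hy.2
        grind
    · refine key (v - t) (fun y hy => ?_) fun hy => ?_
      · have := hγ' y hy
        rw [mem_jumpNbhd]
        grind
      · have h1 := hγ' _ hy.1
        have h2 := hγ' _ hy.2
        grind
    · refine key (v + t) (fun y hy => ?_) fun hy => ?_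
      · have := hγ' y hy
        rw [mem_jumpNbhd]
        grind
      · have h1 := hγ' _ hy.1
        have h2 := hγ' _ hy.2
        grind

end Circulant

/-! ### Cosets and cycles of tetrahedra -/

section Components

variable {R : Type*} [CommRing R] {s t : R}

/-- The subgroup whose cosets are the vertex sets of the components of the neighborhood complex. -/
def jumpSubgroup (s t : R) : AddSubgroup R :=
  AddSubgroup.zmultiples (2 * t) ⊔ AddSubgroup.zmultiples (s + t)

/-- The number of tetrahedra in a component. -/
noncomputable def jumpLength (s t : R) : ℕ :=
  addOrderOf (QuotientAddGroup.mk (s + t) : R ⧸ AddSubgroup.zmultiples (2 * t))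

theorem mem_zmultiples_two_mul_iff (h : IsGarlandPair s t) {x : R} :
    x ∈ AddSubgroup.zmultiples (2 * t) ↔ x = 0 ∨ x = 2 * t := by
  have h4 := h.four_mul_right
  rw [AddSubgroup.mem_zmultiples_iff]
  constructor
  · rintro ⟨k, rfl⟩
    rcases Int.even_or_odd' k with ⟨l, rfl | rfl⟩
    · left
      simp only [zsmul_eq_mul]
      push_cast
      linear_combination (l : R) * h4
    · right
      simp only [zsmul_eq_mul]
      push_cast
      linear_combination (l : R) * h4
  · rintro (rfl | rfl)
    · exact ⟨0, by simp⟩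
    · exact ⟨1, by simp⟩

theorem jumpLength_dvd_iff (h : IsGarlandPair s t) {k : ℤ} :
    (jumpLength s t : ℤ) ∣ k ↔ (k : R) * (s + t) = 0 ∨ (k : R) * (s + t) = 2 * t := by
  rw [jumpLength, addOrderOf_dvd_iff_zsmul_eq_zero, ← QuotientAddGroup.mk_zsmul,
    QuotientAddGroup.eq_zero_iff, mem_zmultiples_two_mul_iff h, zsmul_eq_mul]

theorem four_le_jumpLength [Finite R] (h : IsGarlandPair s t) : 4 ≤ jumpLength s t := by
  have hpos : 0 < jumpLength s t := addOrderOf_pos _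
  by_contra! hlt
  have key := (jumpLength_dvd_iff h).1 (dvd_refl (jumpLength s t : ℤ))
  obtain ⟨g1, g2, g3, g4, g5, g6, g7⟩ := h
  -- Using `4t = 0`, length `1` would give `2s = 2t`, length `2` would give `2s = 2t` or `2s = 0`,
  -- and length `3` would give `3s = t` or `3s = -t`.
  have g8 : 3 * (s + t) ≠ 0 := fun h => g6 (by linear_combination h - g1)
  generalize jumpLength s t = m at *
  interval_cases m <;> push_cast at key <;> grind

/-- The initial vertex of the `i`-th gluing edge of the component of `a`. -/
def edgeStart (s t a : R) {m : ℕ} (i : ZMod m) : R := a + (i.val : R) * (s + t)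

/-- The terminal vertex of the `i`-th gluing edge of the component of `a`. -/
def edgeEnd (s t a : R) {m : ℕ} (i : ZMod m) : R := edgeStart s t a i + 2 * t

variable {a : R}

theorem eq_of_edgeStart_sub [Finite R] (h : IsGarlandPair s t) {i j : ZMod (jumpLength s t)}
    (hij : edgeStart s t a i - edgeStart s t a j = 0 ∨
      edgeStart s t a i - edgeStart s t a j = 2 * t) : i = j := by
  have : NeZero (jumpLength s t) := ⟨by have := four_le_jumpLength h; omega⟩
  have h1 : (jumpLength s t : ℤ) ∣ (i.val : ℤ) - j.val := by
    rw [jumpLength_dvd_iff h]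
    convert hij using 2 <;> simp only [edgeStart] <;> push_cast <;> ring
  rw [← ZMod.intCast_zmod_eq_zero_iff_dvd] at h1
  push_cast at h1
  rwa [ZMod.natCast_zmod_val, ZMod.natCast_zmod_val, sub_eq_zero] at h1

theorem edgeStart_injective [Finite R] (h : IsGarlandPair s t) :
    Function.Injective (edgeStart s t a : ZMod (jumpLength s t) → R) :=
  fun _ _ hij => eq_of_edgeStart_sub h (Or.inl (sub_eq_zero.2 hij))

theorem edgeEnd_injective [Finite R] (h : IsGarlandPair s t) :
    Function.Injective (edgeEnd s t a : ZMod (jumpLength s t) → R) :=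
  fun _ _ hij => edgeStart_injective h (add_right_cancel hij)

theorem edgeStart_ne_edgeEnd [Finite R] (h : IsGarlandPair s t) (i j : ZMod (jumpLength s t)) :
    edgeStart s t a i ≠ edgeEnd s t a j := by
  intro hij
  obtain rfl := eq_of_edgeStart_sub h (Or.inr (sub_eq_iff_eq_add'.2 hij))
  exact h.two_mul_right (by simpa [edgeEnd] using hij)

/-- The second case can occur when the index wraps around: `m(s + t)` is only known to be `0` or
`2t`. The last edge may be glued to the first with its endpoints swapped, which leaves the vertex
sets of the tetrahedra unchanged. -/
theorem edgeStart_add_one [Finite R] (h : IsGarlandPair s t) (i : ZMod (jumpLength s t)) :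
    edgeStart s t a (i + 1) = edgeStart s t a i + (s + t) ∨
      edgeStart s t a (i + 1) = edgeStart s t a i + (s + t) + 2 * t := by
  have : NeZero (jumpLength s t) := ⟨by have := four_le_jumpLength h; omega⟩
  have h1 : (jumpLength s t : ℤ) ∣ ((i + 1).val : ℤ) - (i.val + 1) := by
    rw [← ZMod.intCast_zmod_eq_zero_iff_dvd]
    push_cast
    rw [ZMod.natCast_zmod_val, ZMod.natCast_zmod_val, sub_self]
  rw [jumpLength_dvd_iff h] at h1
  push_cast at h1
  simp only [edgeStart]
  rcases h1 with h1 | h1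
  · left; linear_combination h1
  · right; linear_combination h1

theorem two_mul_mem_jumpSubgroup : 2 * t ∈ jumpSubgroup s t :=
  AddSubgroup.mem_sup_left (AddSubgroup.mem_zmultiples _)

theorem add_mem_jumpSubgroup : s + t ∈ jumpSubgroup s t :=
  AddSubgroup.mem_sup_right (AddSubgroup.mem_zmultiples _)

theorem edgeStart_sub_mem {m : ℕ} (i : ZMod m) : edgeStart s t a i - a ∈ jumpSubgroup s t := by
  simp only [edgeStart, add_sub_cancel_left, ← nsmul_eq_mul]
  exact nsmul_mem add_mem_jumpSubgroup _

theorem exists_eq_edgeStart_or_edgeEnd [Finite R] (h : IsGarlandPair s t) {v : R}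
    (hv : v - a ∈ jumpSubgroup s t) :
    ∃ i : ZMod (jumpLength s t), v = edgeStart s t a i ∨ v = edgeEnd s t a i := by
  have : NeZero (jumpLength s t) := ⟨by have := four_le_jumpLength h; omega⟩
  obtain ⟨x, hx, y, hy, hxy⟩ := AddSubgroup.mem_sup.1 hv
  obtain ⟨k, rfl⟩ := AddSubgroup.mem_zmultiples_iff.1 hy
  rw [mem_zmultiples_two_mul_iff h] at hx
  have h1 : (jumpLength s t : ℤ) ∣ k - ((k : ZMod (jumpLength s t)).val : ℤ) := by
    rw [← ZMod.intCast_zmod_eq_zero_iff_dvd]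
    push_cast
    rw [ZMod.natCast_zmod_val, sub_self]
  rw [jumpLength_dvd_iff h] at h1
  have h4 := h.four_mul_right
  push_cast at h1
  rw [zsmul_eq_mul] at hxy
  refine ⟨k, ?_⟩
  simp only [edgeEnd, edgeStart]
  rcases hx with rfl | rfl <;> rcases h1 with h1 | h1
  · left; linear_combination h1 - hxy
  · right; linear_combination h1 - hxy
  · right; linear_combination h1 - hxy
  · left; linear_combination h1 - hxy + h4

variable [DecidableEq R]

theorem jumpTetra_add_two_mul (h : IsGarlandPair s t) (v : R) :
    jumpTetra s t (v + 2 * t) = jumpTetra s t v := by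
  have h4 := h.four_mul_right
  ext x
  simp only [jumpTetra, Finset.mem_insert, Finset.mem_singleton]
  grind

theorem cycleTetra_edgeStart_edgeEnd [Finite R] (h : IsGarlandPair s t)
    (i : ZMod (jumpLength s t)) :
    cycleTetra (edgeStart s t a) (edgeEnd s t a) i = jumpTetra s t (edgeStart s t a i) := by
  have h4 := h.four_mul_right
  ext x
  simp only [jumpTetra, cycleTetra, edgeEnd, Finset.mem_insert, Finset.mem_singleton]
  rcases edgeStart_add_one (a := a) h i with h1 | h1
  · rw [h1]
  · rw [h1]
    grind

theorem sub_mem_of_mem_jumpTetra {v x : R} (hx : x ∈ jumpTetra s t v) :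
    x - v ∈ jumpSubgroup s t := by
  have h1 : 2 * t ∈ jumpSubgroup s t := two_mul_mem_jumpSubgroup
  have h2 : s + t ∈ jumpSubgroup s t := add_mem_jumpSubgroup
  simp only [jumpTetra, Finset.mem_insert, Finset.mem_singleton] at hx
  rcases hx with rfl | rfl | rfl | rfl
  · simp [zero_mem]
  · simpa using h1
  · simpa using h2
  · simpa [add_assoc, add_sub_assoc] using add_mem h2 h1

theorem sub_mem_of_mem_jumpNbhd {w x : R} (hx : x ∈ jumpNbhd s t w) :
    x - (w + t) ∈ jumpSubgroup s t := by
  have h1 : 2 * t ∈ jumpSubgroup s t := two_mul_mem_jumpSubgroup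
  have h2 : s + t ∈ jumpSubgroup s t := add_mem_jumpSubgroup
  rcases mem_jumpNbhd.1 hx with rfl | rfl | rfl | rfl
  · convert sub_mem h2 h1 using 1; ring
  · convert neg_mem h2 using 1; ring
  · simp [zero_mem]
  · convert neg_mem h1 using 1; ring

/-- The cycle of tetrahedra boundaries whose vertices form the coset of `a`. -/
noncomputable def tetraCycle (s t a : R) : PreAbstractSimplicialComplex R :=
  ⨆ i : ZMod (jumpLength s t), simplexBoundary (cycleTetra (edgeStart s t a) (edgeEnd s t a) i)

/-- Each tetrahedron stays within one coset. Conversely, a tetrahedron in the coset of `a` starts at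
an endpoint of some gluing edge, and both endpoints give the same tetrahedron. -/
theorem mem_tetraCycle_iff [Finite R] (h : IsGarlandPair s t) {γ : Finset R} :
    γ ∈ tetraCycle s t a ↔
      γ ∈ collapsedNeighborhoodComplex s t Set.univ ∧ ∀ x ∈ γ, x - a ∈ jumpSubgroup s t := by
  rw [tetraCycle, PreAbstractSimplicialComplex.mem_iSup,
    mem_collapsedNeighborhoodComplex_univ_iff h]
  constructor
  · rintro ⟨i, hi⟩
    rw [cycleTetra_edgeStart_edgeEnd h] at hi
    refine ⟨⟨_, hi⟩, fun x hx => ?_⟩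
    convert add_mem (sub_mem_of_mem_jumpTetra (hi.2.1 hx)) (edgeStart_sub_mem (a := a) i) using 1
    ring
  · rintro ⟨⟨v, hv⟩, hγ⟩
    obtain ⟨x, hx⟩ := hv.1
    have hva : v - a ∈ jumpSubgroup s t := by
      convert sub_mem (hγ x hx) (sub_mem_of_mem_jumpTetra (hv.2.1 hx)) using 1
      ring
    obtain ⟨i, rfl | rfl⟩ := exists_eq_edgeStart_or_edgeEnd h hva
    · exact ⟨i, by rwa [cycleTetra_edgeStart_edgeEnd h]⟩
    · refine ⟨i, ?_⟩
      rw [cycleTetra_edgeStart_edgeEnd h]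
      rwa [edgeEnd, jumpTetra_add_two_mul h] at hv

theorem isTetrahedraCycle_tetraCycle [Finite R] (h : IsGarlandPair s t) :
    IsTetrahedraCycle (jumpLength s t) (tetraCycle s t a) :=
  isTetrahedraCycle_iSup_simplexBoundary (edgeStart_injective h) (edgeEnd_injective h)
    (edgeStart_ne_edgeEnd h) (four_le_jumpLength h)

/-- Faces are non-empty, so a common face would have a vertex in both cosets. -/
theorem disjoint_tetraCycle [Finite R] (h : IsGarlandPair s t) {a b : R}
    (hab : a - b ∉ jumpSubgroup s t) : Disjoint (tetraCycle s t a) (tetraCycle s t b) := by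
  intro K hKa hKb γ hγ
  obtain ⟨-, hγa⟩ := (mem_tetraCycle_iff h).1 (hKa hγ)
  obtain ⟨-, hγb⟩ := (mem_tetraCycle_iff h).1 (hKb hγ)
  obtain ⟨x, hx⟩ := (K.isRelLowerSet_faces hγ).1
  refine (hab ?_).elim
  convert sub_mem (hγb x hx) (hγa x hx) using 1
  ring

theorem exists_collapses_iSup_isTetrahedraCycle [Fintype R] (h : IsGarlandPair s t) :
    ∃ (r : ℕ) (Δ : Fin r → PreAbstractSimplicialComplex R),
      (∀ a, IsTetrahedraCycle (jumpLength s t) (Δ a)) ∧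
      Pairwise (fun a b => Disjoint (Δ a) (Δ b)) ∧
      Collapses (neighborhoodComplex (SimpleGraph.circulantGraph {s, t})) (⨆ a, Δ a) := by
  let e := Finite.equivFin (R ⧸ jumpSubgroup s t)
  have hout : ∀ x y : R ⧸ jumpSubgroup s t, x.out - y.out ∈ jumpSubgroup s t → x = y := by
    intro x y hxy
    rw [← QuotientAddGroup.out_eq' x, ← QuotientAddGroup.out_eq' y, eq_comm, QuotientAddGroup.eq]
    convert hxy using 1
    ring
  refine ⟨Nat.card (R ⧸ jumpSubgroup s t), fun k => tetraCycle s t (e.symm k).out,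
    fun k => isTetrahedraCycle_tetraCycle h,
    fun k l hkl => disjoint_tetraCycle h fun hmem => hkl (e.symm.injective (hout _ _ hmem)), ?_⟩
  have hsup : ⨆ k, tetraCycle s t (e.symm k).out =
      collapsedNeighborhoodComplex s t ((Finset.univ : Finset R) : Set R) := by
    refine SetLike.ext fun γ => ?_
    rw [PreAbstractSimplicialComplex.mem_iSup, Finset.coe_univ]
    constructor
    · rintro ⟨k, hk⟩
      exact ((mem_tetraCycle_iff h).1 hk).1
    · intro hγ
      obtain ⟨v, hv⟩ := (mem_collapsedNeighborhoodComplex_univ_iff h).1 hγ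
      refine ⟨e (QuotientAddGroup.mk v), (mem_tetraCycle_iff h).2 ⟨hγ, fun x hx => ?_⟩⟩
      rw [e.symm_apply_apply]
      have h1 : v - (QuotientAddGroup.mk v : R ⧸ jumpSubgroup s t).out ∈ jumpSubgroup s t := by
        rw [sub_eq_neg_add, ← QuotientAddGroup.eq, QuotientAddGroup.out_eq']
      convert add_mem (sub_mem_of_mem_jumpTetra (hv.2.1 hx)) h1 using 1
      ring
  rw [hsup]
  exact collapses_collapsedNeighborhoodComplex h _

end Components

/-! ### Connected components of the realization and their retraction -/

section Realization

theorem exists_ne_zero_of_mem_stdSimplex {V : Type*} [Fintype V] {x : V → ℝ}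
    (hx : x ∈ stdSimplex ℝ V) : ∃ v, x v ≠ 0 := by
  by_contra! h
  simpa [h] using hx.2

variable {R : Type*} [CommRing R]

/-- The mass of the pair `{w + s, w - s}`, which is nonzero only at points of the simplex
spanned by the neighborhood of `w`. -/
noncomputable def pairMass (s : R) (x : R → ℝ) (w : R) : ℝ := min (x (w + s)) (x (w - s))

/-- The retraction of the neighborhood complex that pushes each pair `{w + s, w - s}` towards
`{w + t, w - t}`. -/
noncomputable def pushPairs (s t : R) (x : R → ℝ) (v : R) : ℝ :=
  x v + pairMass s x (v - t) + pairMass s x (v + t) - pairMass s x (v - s) - pairMass s x (v + s)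

theorem continuous_pushPairs (s t : R) : Continuous (pushPairs s t) := by
  unfold pushPairs pairMass
  fun_prop

theorem sum_pushPairs [Fintype R] (s t : R) (x : R → ℝ) : ∑ v, pushPairs s t x v = ∑ v, x v := by
  simp only [pushPairs, Finset.sum_add_distrib, Finset.sum_sub_distrib]
  have h1 : ∀ u : R, ∑ v, pairMass s x (v - u) = ∑ v, pairMass s x v := fun u =>
    Equiv.sum_comp (Equiv.subRight u) (pairMass s x)
  have h2 : ∀ u : R, ∑ v, pairMass s x (v + u) = ∑ v, pairMass s x v := fun u =>
    Equiv.sum_comp (Equiv.addRight u) (pairMass s x)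
  rw [h1, h1, h2, h2]
  ring

theorem pairMass_nonneg [Fintype R] {s : R} {x : R → ℝ} (hx : x ∈ stdSimplex ℝ R) (w : R) :
    0 ≤ pairMass s x w :=
  le_min (hx.1 _) (hx.1 _)

variable [Fintype R] [DecidableEq R] {s t : R}

theorem mem_geometricRealization_neighborhoodComplex (h : IsGarlandPair s t) {x : R → ℝ} :
    x ∈ geometricRealization (neighborhoodComplex (SimpleGraph.circulantGraph {s, t})) ↔
      x ∈ stdSimplex ℝ R ∧ ∃ w, ∀ v, x v ≠ 0 → v ∈ jumpNbhd s t w := by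
  refine and_congr_right fun _ => ⟨?_, ?_⟩
  · rintro ⟨σ, hσ, hx⟩
    obtain ⟨-, w, hw⟩ := (mem_neighborhoodComplex_circulantGraph h).1 hσ
    exact ⟨w, fun v hv => hw (hx v hv)⟩
  · rintro ⟨w, hw⟩
    exact ⟨jumpNbhd s t w, (mem_neighborhoodComplex_circulantGraph h).2
      ⟨⟨w + s, by simp [mem_jumpNbhd]⟩, w, subset_rfl⟩, hw⟩

theorem segment_subset_of_support_jumpNbhd {x y : R → ℝ} {w : R}
    (hx : x ∈ stdSimplex ℝ R) (hxw : ∀ v, x v ≠ 0 → v ∈ jumpNbhd s t w)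
    (hy : y ∈ stdSimplex ℝ R) (hyw : ∀ v, y v ≠ 0 → v ∈ jumpNbhd s t w) {z : R → ℝ}
    (hz : z ∈ segment ℝ x y) : z ∈ stdSimplex ℝ R ∧ ∀ v, z v ≠ 0 → v ∈ jumpNbhd s t w := by
  refine ⟨(convex_stdSimplex ℝ R).segment_subset hx hy hz, fun v hv => ?_⟩
  obtain ⟨a, b, -, -, -, rfl⟩ := hz
  by_contra hvw
  have h1 : x v = 0 := by_contra fun h => hvw (hxw v h)
  have h2 : y v = 0 := by_contra fun h => hvw (hyw v h)
  simp [h1, h2] at hv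

theorem joinedIn_of_support_jumpNbhd (h : IsGarlandPair s t) {x y : R → ℝ} {w : R}
    (hx : x ∈ stdSimplex ℝ R) (hxw : ∀ v, x v ≠ 0 → v ∈ jumpNbhd s t w)
    (hy : y ∈ stdSimplex ℝ R) (hyw : ∀ v, y v ≠ 0 → v ∈ jumpNbhd s t w) :
    JoinedIn (geometricRealization (neighborhoodComplex (SimpleGraph.circulantGraph {s, t}))) x y :=
  JoinedIn.of_segment_subset fun _ hz =>
    have := segment_subset_of_support_jumpNbhd hx hxw hy hyw hz
    (mem_geometricRealization_neighborhoodComplex h).2 ⟨this.1, w, this.2⟩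

theorem joinedIn_single_of_mem_jumpNbhd (h : IsGarlandPair s t) {v v' w : R}
    (hv : v ∈ jumpNbhd s t w) (hv' : v' ∈ jumpNbhd s t w) :
    JoinedIn (geometricRealization (neighborhoodComplex (SimpleGraph.circulantGraph {s, t})))
      (Pi.single v 1) (Pi.single v' 1) := by
  have hsupp : ∀ u ∈ jumpNbhd s t w, ∀ u', (Pi.single u 1 : R → ℝ) u' ≠ 0 →
      u' ∈ jumpNbhd s t w := by
    intro u hu u' hu'
    rcases eq_or_ne u' u with rfl | hne
    · exact hu
    · simp [hne] at hu'
  exact joinedIn_of_support_jumpNbhd h (single_mem_stdSimplex ℝ v) (hsupp v hv)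
    (single_mem_stdSimplex ℝ v') (hsupp v' hv')

/-- The `g` for which every vertex `v` is joined to `v + g` form a subgroup. It contains both
generators: `v` and `v + 2t` are neighbors of `v + t`, while `v` and `v + (s + t)` are neighbors of
`v + s`. -/
theorem joinedIn_single_add (h : IsGarlandPair s t) {g : R} (hg : g ∈ jumpSubgroup s t) (v : R) :
    JoinedIn (geometricRealization (neighborhoodComplex (SimpleGraph.circulantGraph {s, t})))
      (Pi.single v 1) (Pi.single (v + g) 1) := by
  let J : AddSubgroup R :=
    { carrier := {g | ∀ v, JoinedIn
        (geometricRealization (neighborhoodComplex (SimpleGraph.circulantGraph {s, t})))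
        (Pi.single v 1) (Pi.single (v + g) 1)}
      zero_mem' := fun v => by
        simpa using joinedIn_single_of_mem_jumpNbhd h (v := v) (v' := v) (w := v - s)
          (by simp [mem_jumpNbhd]) (by simp [mem_jumpNbhd])
      add_mem' := fun {g g'} hg hg' v => by
        simpa [add_assoc] using (hg v).trans (hg' (v + g))
      neg_mem' := fun {g} hg v => by simpa using (hg (v + -g)).symm }
  suffices jumpSubgroup s t ≤ J from this hg v
  refine sup_le (AddSubgroup.zmultiples_le_of_mem fun v => ?_)
    (AddSubgroup.zmultiples_le_of_mem fun v => ?_)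
  · exact joinedIn_single_of_mem_jumpNbhd h (w := v + t) (by simp [mem_jumpNbhd])
      (by rw [mem_jumpNbhd]; right; right; left; ring)
  · exact joinedIn_single_of_mem_jumpNbhd h (w := v + s) (by simp [mem_jumpNbhd])
      (by rw [mem_jumpNbhd]; right; right; left; ring)

/-- The part of the realization of the neighborhood complex over the coset of `a`. -/
def cosetRealization (s t a : R) : Set (R → ℝ) :=
  {x | x ∈ geometricRealization (neighborhoodComplex (SimpleGraph.circulantGraph {s, t})) ∧
    ∀ v, x v ≠ 0 → v - a ∈ jumpSubgroup s t}

theorem joinedIn_single_of_mem_cosetRealization (h : IsGarlandPair s t) {a : R} {x : R → ℝ}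
    (hx : x ∈ cosetRealization s t a) :
    JoinedIn (geometricRealization (neighborhoodComplex (SimpleGraph.circulantGraph {s, t})))
      (Pi.single a 1) x := by
  obtain ⟨hx, hxa⟩ := hx
  obtain ⟨hx0, w, hw⟩ := (mem_geometricRealization_neighborhoodComplex h).1 hx
  obtain ⟨v, hv⟩ := exists_ne_zero_of_mem_stdSimplex hx0
  have h1 := joinedIn_single_add h (hxa v hv) a
  rw [add_sub_cancel] at h1
  refine h1.trans (joinedIn_of_support_jumpNbhd h (w := w) (single_mem_stdSimplex ℝ v) ?_ hx0 hw)
  intro u hu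
  rcases eq_or_ne u v with rfl | hne
  · exact hw u hv
  · simp [hne] at hu

theorem mem_cosetRealization_of_ne_zero (h : IsGarlandPair s t) {a : R} {x : R → ℝ}
    (hx : x ∈ geometricRealization (neighborhoodComplex (SimpleGraph.circulantGraph {s, t})))
    {u : R} (hu : x u ≠ 0) (hua : u - a ∈ jumpSubgroup s t) : x ∈ cosetRealization s t a := by
  obtain ⟨-, w, hw⟩ := (mem_geometricRealization_neighborhoodComplex h).1 hx
  refine ⟨hx, fun v hv => ?_⟩
  convert add_mem (sub_mem (sub_mem_of_mem_jumpNbhd (hw v hv)) (sub_mem_of_mem_jumpNbhd (hw u hu)))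
    hua using 1
  ring

/-- The support of a point lies in one neighborhood, hence in one coset. So being supported on the
coset of `a` means vanishing off it (closed) and also being nonzero somewhere on it (open). Within
the coset, paths lead to the vertex `a`. -/
theorem connectedComponent_eq_cosetRealization (h : IsGarlandPair s t) {a : R}
    (x : geometricRealization (neighborhoodComplex (SimpleGraph.circulantGraph {s, t})))
    (hx : x.1 ∈ cosetRealization s t a) :
    connectedComponent x = Subtype.val ⁻¹' cosetRealization s t a := by
  have hcont : ∀ v, Continuous fun y : geometricRealization
      (neighborhoodComplex (SimpleGraph.circulantGraph {s, t})) => y.1 v := fun v =>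
    (continuous_apply v).comp continuous_subtype_val
  apply subset_antisymm
  · refine IsClopen.connectedComponent_subset ⟨?_, ?_⟩ hx
    · have : (Subtype.val ⁻¹' cosetRealization s t a : Set (geometricRealization
          (neighborhoodComplex (SimpleGraph.circulantGraph {s, t})))) =
          ⋂ v, ⋂ (_ : v - a ∉ jumpSubgroup s t), {y | y.1 v = 0} := by
        ext y
        simp only [Set.mem_preimage, Set.mem_iInter, Set.mem_ofPred]
        exact ⟨fun hy v hv => by_contra fun hyv => hv (hy.2 v hyv),
          fun hy => ⟨y.2, fun v hv => by_contra fun hva => hv (hy v hva)⟩⟩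
      rw [this]
      exact isClosed_iInter fun v => isClosed_iInter fun _ =>
        isClosed_eq (hcont v) continuous_const
    · have : (Subtype.val ⁻¹' cosetRealization s t a : Set (geometricRealization
          (neighborhoodComplex (SimpleGraph.circulantGraph {s, t})))) =
          ⋃ v, ⋃ (_ : v - a ∈ jumpSubgroup s t), {y | y.1 v ≠ 0} := by
        ext y
        simp only [Set.mem_preimage, Set.mem_iUnion, Set.mem_ofPred, exists_prop]
        constructor
        · intro hy
          obtain ⟨v, hv⟩ := exists_ne_zero_of_mem_stdSimplex y.2.1
          exact ⟨v, hy.2 v hv, hv⟩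
        · rintro ⟨v, hva, hv⟩
          exact mem_cosetRealization_of_ne_zero h y.2 hv hva
      rw [this]
      exact isOpen_iUnion fun v => isOpen_iUnion fun _ =>
        isOpen_ne_fun (hcont v) continuous_const
  · intro y hy
    have h1 := (joinedIn_single_of_mem_cosetRealization h hx).symm.trans
      (joinedIn_single_of_mem_cosetRealization h hy)
    exact pathComponent_subset_component x h1.joined_subtype

/-- On the simplex of `w`, only the pair of `w` contributes to `pushPairs`. Its formula sums over
all relevant pairs, so continuity is evident without a choice of `w`. -/
theorem pairMass_eq_zero (h : IsGarlandPair s t) {x : R → ℝ} (hx : x ∈ stdSimplex ℝ R) {w u : R}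
    (hw : ∀ v, x v ≠ 0 → v ∈ jumpNbhd s t w) (hu : u ≠ w) : pairMass s x u = 0 := by
  by_contra hne
  have h1 := hx.1 (u + s)
  have h2 := hx.1 (u - s)
  refine hu (eq_of_mem_jumpNbhd h (hw _ fun h0 => hne ?_) (hw _ fun h0 => hne ?_))
  · rw [pairMass, h0, min_eq_left h2]
  · rw [pairMass, h0, min_eq_right h1]

theorem pushPairs_apply_add_left (h : IsGarlandPair s t) {x : R → ℝ} (hx : x ∈ stdSimplex ℝ R)
    {w : R} (hw : ∀ v, x v ≠ 0 → v ∈ jumpNbhd s t w) :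
    pushPairs s t x (w + s) = x (w + s) - pairMass s x w := by
  have hz := fun u => pairMass_eq_zero (u := u) h hx hw
  obtain ⟨g1, g2, g3, g4, g5, g6, g7⟩ := h
  rw [pushPairs, hz (w + s - t) (by grind), hz (w + s + t) (by grind),
    hz (w + s + s) (by grind), add_sub_cancel_right]
  ring

theorem pushPairs_apply_sub_left (h : IsGarlandPair s t) {x : R → ℝ} (hx : x ∈ stdSimplex ℝ R)
    {w : R} (hw : ∀ v, x v ≠ 0 → v ∈ jumpNbhd s t w) :
    pushPairs s t x (w - s) = x (w - s) - pairMass s x w := by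
  have hz := fun u => pairMass_eq_zero (u := u) h hx hw
  obtain ⟨g1, g2, g3, g4, g5, g6, g7⟩ := h
  rw [pushPairs, hz (w - s - t) (by grind), hz (w - s + t) (by grind),
    hz (w - s - s) (by grind), sub_add_cancel]
  ring

theorem pushPairs_apply_of_ne (h : IsGarlandPair s t) {x : R → ℝ} (hx : x ∈ stdSimplex ℝ R)
    {w v : R} (hw : ∀ v, x v ≠ 0 → v ∈ jumpNbhd s t w) (h₁ : v ≠ w + s) (h₂ : v ≠ w - s) :
    pushPairs s t x v = x v + pairMass s x (v - t) + pairMass s x (v + t) := by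
  have hz := fun u => pairMass_eq_zero (u := u) h hx hw
  rw [pushPairs, hz (v - s) (by grind), hz (v + s) (by grind), sub_zero, sub_zero]

theorem pushPairs_mem_stdSimplex (h : IsGarlandPair s t) {x : R → ℝ} (hx : x ∈ stdSimplex ℝ R)
    {w : R} (hw : ∀ v, x v ≠ 0 → v ∈ jumpNbhd s t w) : pushPairs s t x ∈ stdSimplex ℝ R := by
  refine ⟨fun v => ?_, (sum_pushPairs s t x).trans hx.2⟩
  by_cases h1 : v = w + s
  · rw [h1, pushPairs_apply_add_left h hx hw]
    exact sub_nonneg.2 (min_le_left _ _)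
  by_cases h2 : v = w - s
  · rw [h2, pushPairs_apply_sub_left h hx hw]
    exact sub_nonneg.2 (min_le_right _ _)
  · rw [pushPairs_apply_of_ne h hx hw h1 h2]
    exact add_nonneg (add_nonneg (hx.1 v) (pairMass_nonneg hx _)) (pairMass_nonneg hx _)

theorem mem_jumpNbhd_of_pushPairs_ne_zero (h : IsGarlandPair s t) {x : R → ℝ}
    (hx : x ∈ stdSimplex ℝ R) {w : R} (hw : ∀ v, x v ≠ 0 → v ∈ jumpNbhd s t w) {v : R}
    (hv : pushPairs s t x v ≠ 0) : v ∈ jumpNbhd s t w := by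
  by_contra hvw
  have hxv : x v = 0 := by_contra fun h => hvw (hw v h)
  rw [mem_jumpNbhd] at hvw
  push Not at hvw
  obtain ⟨h1, h2, h3, h4⟩ := hvw
  rw [pushPairs_apply_of_ne h hx hw h1 h2, hxv, pairMass_eq_zero h hx hw (by grind),
    pairMass_eq_zero h hx hw (by grind)] at hv
  simp at hv

theorem mem_geometricRealization_tetraCycle (h : IsGarlandPair s t) {a : R} {x : R → ℝ} {w : R}
    (hx : x ∈ stdSimplex ℝ R) (hw : ∀ v, x v ≠ 0 → v ∈ jumpNbhd s t w)
    (hxw : x (w + s) = 0 ∨ x (w - s) = 0) (ha : ∀ v, x v ≠ 0 → v - a ∈ jumpSubgroup s t) :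
    x ∈ geometricRealization (tetraCycle s t a) := by
  let σ : Finset R := {v | x v ≠ 0}
  have hσ : ∀ {v}, v ∈ σ ↔ x v ≠ 0 := by simp [σ]
  have hsub : σ ⊆ jumpNbhd s t w := fun v hv => hw v (hσ.1 hv)
  refine ⟨hx, σ, (mem_tetraCycle_iff h).2 ⟨⟨(mem_neighborhoodComplex_circulantGraph h).2
    ⟨?_, w, hsub⟩, ?_⟩, fun v hv => ha v (hσ.1 hv)⟩, fun v hv => hσ.2 hv⟩
  · obtain ⟨v, hv⟩ := exists_ne_zero_of_mem_stdSimplex hx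
    exact ⟨v, hσ.2 hv⟩
  · rintro w' - ⟨h1, h2⟩
    obtain rfl := eq_of_mem_jumpNbhd h (hsub h1) (hsub h2)
    exact hxw.elim (hσ.1 h1) (hσ.1 h2)

/-- On the simplex of `w`, `pushPairs` subtracts the smaller of the coordinates at `w + s` and `w -
s` from both, so one of them becomes `0` and the image avoids the collapsed faces. The segment to
the image stays in that simplex, and points of the cycle have no pair mass, hence are fixed. -/
theorem nonempty_homotopyEquiv_cosetRealization (h : IsGarlandPair s t) (a : R) :
    Nonempty (ContinuousMap.HomotopyEquiv (cosetRealization s t a)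
      (geometricRealization (tetraCycle s t a))) := by
  have hcoset : ∀ {x : R → ℝ} {w v : R}, x ∈ cosetRealization s t a →
      (∀ v, x v ≠ 0 → v ∈ jumpNbhd s t w) → v ∈ jumpNbhd s t w → v - a ∈ jumpSubgroup s t := by
    intro x w v hx hw hv
    obtain ⟨u, hu⟩ := exists_ne_zero_of_mem_stdSimplex hx.1.1
    convert add_mem (sub_mem (sub_mem_of_mem_jumpNbhd hv) (sub_mem_of_mem_jumpNbhd (hw u hu)))
      (hx.2 u hu) using 1
    ring
  refine nonempty_homotopyEquiv_of_retraction (continuous_pushPairs s t) ?_ ?_ ?_ ?_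
  · rintro x ⟨hx, σ, hσ, hxσ⟩
    obtain ⟨⟨hσN, -⟩, hσa⟩ := (mem_tetraCycle_iff h).1 hσ
    exact ⟨⟨hx, σ, hσN, hxσ⟩, fun v hv => hσa v (hxσ v hv)⟩
  · intro x hxa
    obtain ⟨hx, w, hw⟩ := (mem_geometricRealization_neighborhoodComplex h).1 hxa.1
    refine mem_geometricRealization_tetraCycle h (pushPairs_mem_stdSimplex h hx hw)
      (fun v => mem_jumpNbhd_of_pushPairs_ne_zero h hx hw) ?_
      fun v hv => hcoset hxa hw (mem_jumpNbhd_of_pushPairs_ne_zero h hx hw hv)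
    rw [pushPairs_apply_add_left h hx hw, pushPairs_apply_sub_left h hx hw, pairMass]
    rcases min_choice (x (w + s)) (x (w - s)) with h1 | h1 <;> simp [h1]
  · rintro x ⟨hx, σ, hσ, hxσ⟩
    obtain ⟨⟨-, hS⟩, -⟩ := (mem_tetraCycle_iff h).1 hσ
    have hzero : ∀ w, pairMass s x w = 0 := by
      intro w
      have h1 := hx.1 (w + s)
      have h2 := hx.1 (w - s)
      by_contra hne
      refine hS w trivial ⟨hxσ _ fun h0 => hne ?_, hxσ _ fun h0 => hne ?_⟩
      · rw [pairMass, h0, min_eq_left h2]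
      · rw [pairMass, h0, min_eq_right h1]
    funext v
    simp [pushPairs, hzero]
  · intro x hxa z hz
    obtain ⟨hx, w, hw⟩ := (mem_geometricRealization_neighborhoodComplex h).1 hxa.1
    obtain ⟨hz0, hzw⟩ := segment_subset_of_support_jumpNbhd hx hw
      (pushPairs_mem_stdSimplex h hx hw)
      (fun v => mem_jumpNbhd_of_pushPairs_ne_zero h hx hw) hz
    exact ⟨(mem_geometricRealization_neighborhoodComplex h).2 ⟨hz0, w, hzw⟩,
      fun v hv => hcoset hxa hw (hzw v hv)⟩

theorem exists_sphereGarland_homotopyEquiv_connectedComponent (h : IsGarlandPair s t)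
    (x : geometricRealization (neighborhoodComplex (SimpleGraph.circulantGraph {s, t}))) :
    ∃ (Y : Type) (_ : TopologicalSpace Y), IsSphereGarland (jumpLength s t) Y ∧
      Nonempty (ContinuousMap.HomotopyEquiv (connectedComponent x) Y) := by
  have : NeZero (jumpLength s t) := ⟨by have := four_le_jumpLength h; omega⟩
  obtain ⟨a, ha⟩ := exists_ne_zero_of_mem_stdSimplex x.2.1
  have hxa : x.1 ∈ cosetRealization s t a :=
    mem_cosetRealization_of_ne_zero h x.2 ha (by simp [zero_mem])
  obtain ⟨Y, τ, hY, ⟨e⟩⟩ := exists_sphereGarland_homotopyEquiv (edgeStart_injective (a := a) h)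
    (edgeEnd_injective h) (edgeStart_ne_edgeEnd h) (four_le_jumpLength h)
  obtain ⟨e'⟩ := nonempty_homotopyEquiv_cosetRealization h a
  let φ : (Subtype.val ⁻¹' cosetRealization s t a : Set (geometricRealization
      (neighborhoodComplex (SimpleGraph.circulantGraph {s, t})))) ≃ₜ cosetRealization s t a :=
    { toFun := fun z => ⟨z.1.1, z.2⟩
      invFun := fun z => ⟨⟨z.1, z.2.1⟩, z.2⟩
      left_inv := fun _ => rfl
      right_inv := fun _ => rfl
      continuous_toFun := by fun_prop
      continuous_invFun := by fun_prop }
  refine ⟨Y, τ, hY, ?_⟩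
  rw [connectedComponent_eq_cosetRealization h x hxa]
  exact ⟨φ.toHomotopyEquiv.trans (e'.trans e)⟩

end Realization

/-! ### Translation from integers to `ℤ/n`, and conclusion -/

theorem isGarlandPair_natCast (n s t : ℕ)
    (hs : 1 ≤ s ∧ s ≤ n / 2) (ht : 1 ≤ t) (h2s : 2 * s ≠ n) (h3st : 3 * s + t ≠ n)
    (h3st' : 3 * (s : ℤ) - t ≠ n) (h3s : 3 * s ≠ t) (h4t : 4 * t = n) :
    IsGarlandPair (s : ZMod n) (t : ZMod n) := by
  have key : ∀ k : ℤ, (k : ZMod n) = 0 → ∃ c : ℤ, k = n * c := fun k hk =>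
    (ZMod.intCast_zmod_eq_zero_iff_dvd k n).1 hk |>.imp fun _ h => h
  -- All combinations of `s` and `t` to be excluded lie strictly between `-2n` and `2n`, so just
  -- three multiples of `n` matter.
  have hcases : ∀ k : ℤ, (k : ZMod n) = 0 → -2 * (n : ℤ) < k → k < 2 * n →
      k = -n ∨ k = 0 ∨ k = n := by
    intro k hk h1 h2
    obtain ⟨c, rfl⟩ := key k hk
    have hn : (0 : ℤ) < n := by omega
    have h3 : -2 < c := by nlinarith
    have h4 : c < 2 := by nlinarith
    interval_cases c <;> omega
  refine ⟨?_, ?_, ?_, ?_, ?_, ?_, ?_⟩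
  · rw [← ZMod.natCast_self n, ← h4t]
    push_cast
    rfl
  · intro h
    have := hcases (2 * t) (by push_cast; exact h) (by omega) (by omega)
    omega
  · intro h
    have := hcases (2 * s) (by push_cast; exact h) (by omega) (by omega)
    omega
  · intro h
    -- The case `4s = n = 4t` would give `s = t` and hence `3s + t = n`.
    have := hcases (4 * s) (by push_cast; exact h) (by omega) (by omega)
    omega
  · intro h
    have := hcases (2 * s - 2 * t) (by push_cast; exact sub_eq_zero.2 h) (by omega) (by omega)
    omega
  · intro h
    have := hcases (3 * s - t) (by push_cast; exact sub_eq_zero.2 h) (by omega) (by omega)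
    omega
  · intro h
    have := hcases (3 * s + t) (by push_cast; rw [h]; simp) (by omega) (by omega)
    omega

theorem theorem4p6 (n s t : ℕ) [NeZero n]
    (hs : 1 ≤ s ∧ s ≤ n / 2) (ht : 1 ≤ t ∧ t ≤ n / 2)
    (h2s : 2 * s ≠ n) (h2t : 2 * t ≠ n) (h2st : 2 * (s + t) ≠ n)
    (h3st : 3 * s + t ≠ n) (h3st' : 3 * (s : ℤ) - t ≠ n) (h4s : 4 * s ≠ n)
    (h3s : 3 * s ≠ t) (h3t : 3 * t ≠ s) (h4t : 4 * t = n) :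
    ∃ m : ℕ, 4 ≤ m ∧
      (∃ (r : ℕ) (Δ : Fin r → PreAbstractSimplicialComplex (ZMod n)),
        (∀ a, IsTetrahedraCycle m (Δ a)) ∧
        Pairwise (fun a b => Disjoint (Δ a) (Δ b)) ∧
        Collapses
          (neighborhoodComplex (SimpleGraph.circulantGraph ({(s : ZMod n), (t : ZMod n)})))
          (⨆ a, Δ a)) ∧
      (∀ x : geometricRealization
          (neighborhoodComplex (SimpleGraph.circulantGraph ({(s : ZMod n), (t : ZMod n)}))),
        ∃ (Y : Type) (_ : TopologicalSpace Y), IsSphereGarland m Y ∧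
          Nonempty (ContinuousMap.HomotopyEquiv (connectedComponent x) Y)) := by
  have h := isGarlandPair_natCast n s t hs ht.1 h2s h3st h3st' h3s h4t
  exact ⟨jumpLength (s : ZMod n) (t : ZMod n), four_le_jumpLength h,
    exists_collapses_iSup_isTetrahedraCycle h,
    exists_sphereGarland_homotopyEquiv_connectedComponent h⟩
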